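/- Let $\mathcal X,\mathcal Y$ be finite sets and let $(X_i,Y_i)$, $i\ge 1$, be i.i.d. pairs with a fixed law $P_{X,Y}$ on $\mathcal X\times\mathcal Y$. A relay that observes both source sequences $(X^n,Y^n)$ publicly broadcasts $W_c=f_r(X^n,Y^n)$, which takes values in a finite set $\mathcal W_c^{(n)}$; User 1 forms the key $K_1=g_1(W_c,X^n)$ and User 2 forms the key $K_2=g_2(W_c,Y^n)$, both in a finite set $\mathcal K^{(n)}$ (all maps are deterministic). A pair $(R_c,R_k)\in\mathbb R_+^2$, where $\mathbb R_+=[0,\infty)$, is achievable if for every $\delta>0$ there is a sequence of such codes with, for all sufficiently large $n$, $$\Pr(K_1\ne K_2)\le\delta,\quad \tfrac1n\log|\mathcal W_c^{(n)}|\le R_c+\delta,\quad \tfrac1nH(K_1)\ge R_k-\delta,\quad \tfrac1nI(K_1,K_2;W_c)\le\delta .$$ The communication-key rate region is the closure of the set of achievable pairs. (Entropies, informations and logarithms are in base 2.) Theorem. The communication-key rate region is exactly the set of all $(R_c,R_k)\in\mathbb R_+^2$ for which there are a finite set $\mathcal V$ with $|\mathcal V|\le|\mathcal X||\mathcal Y|+2$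 and a conditional law $P_{V|X,Y}$ on $\mathcal V$ such that, under $P_{X,Y}P_{V|X,Y}$, $$R_c\ge\max\{I(X;V|Y),\,I(Y;V|X)\}\quad\text{and}\quad R_k\le\min\{I(X;V),\,I(Y;V)\}.$$ -/

import Mathlib

namespace KeyRelay

/-- Probability of the event `S` under the mass function `q` on a finite sample space. -/
noncomputable def prob {Ω : Type*} [Fintype Ω] (q : Ω → ℝ) (S : Set Ω) : ℝ :=
  ∑ ω, S.indicator q ω

/-- Shannon entropy `H(A)`, in bits, of the finite-valued random variable `A : Ω → α` when `Ω`
carries the mass function `q` (with `0 log 0 = 0`). -/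
noncomputable def entropy {Ω α : Type*} [Fintype Ω] [Fintype α] (q : Ω → ℝ) (A : Ω → α) : ℝ :=
  ∑ a, Real.negMulLog (prob q {ω | A ω = a}) / Real.log 2

/-- Conditional entropy `H(A | C) = H(A, C) - H(C)`. -/
noncomputable def condEntropy {Ω α γ : Type*} [Fintype Ω] [Fintype α] [Fintype γ]
    (q : Ω → ℝ) (A : Ω → α) (C : Ω → γ) : ℝ :=
  entropy q (fun ω => (A ω, C ω)) - entropy q C

/-- Mutual information `I(A ; B) = H(A) - H(A | B)`. -/
noncomputable def mutualInfo {Ω α β : Type*} [Fintype Ω] [Fintype α] [Fintype β]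
    (q : Ω → ℝ) (A : Ω → α) (B : Ω → β) : ℝ :=
  entropy q A - condEntropy q A B

/-- Conditional mutual information `I(A ; B | C) = H(A | C) - H(A | B, C)`. -/
noncomputable def condMutualInfo {Ω α β γ : Type*} [Fintype Ω] [Fintype α] [Fintype β]
    [Fintype γ] (q : Ω → ℝ) (A : Ω → α) (B : Ω → β) (C : Ω → γ) : ℝ :=
  condEntropy q A C - condEntropy q A (fun ω => (B ω, C ω))

/-- The law of `(Xⁿ, Yⁿ)`, with i.i.d. pairs `(X_i, Y_i)` of law `p`. -/
noncomputable def iidLaw {X Y : Type*} (p : X × Y → ℝ) (n : ℕ) :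
    (Fin n → X) × (Fin n → Y) → ℝ :=
  fun ω => ∏ i, p (ω.1 i, ω.2 i)

/-- The law `P_{X,Y} P_{V|X,Y}` of `((X, Y), V)`; `w z` is the conditional law of `V` given
`(X, Y) = z`. -/
noncomputable def jointLaw {X Y V : Type*} (p : X × Y → ℝ) (w : X × Y → V → ℝ) :
    (X × Y) × V → ℝ :=
  fun z => p z.1 * w z.1 z.2

/-- A code of blocklength `n` for key generation through a relay that observes `(Xⁿ, Yⁿ)`:
the relay broadcasts one of `numMsg` messages, and each user computes one of `numKey` keys from
the message and its own source sequence. -/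
structure Code (X Y : Type*) (n : ℕ) where
  /-- the number of broadcast messages -/
  numMsg : ℕ
  /-- the number of keys -/
  numKey : ℕ
  /-- the relay mapping -/
  relay : (Fin n → X) × (Fin n → Y) → Fin numMsg
  /-- the decoder of User 1 -/
  dec₁ : Fin numMsg × (Fin n → X) → Fin numKey
  /-- the decoder of User 2 -/
  dec₂ : Fin numMsg × (Fin n → Y) → Fin numKey

/-- The key `K₁` of User 1, as a random variable on the source sequences. -/
def Code.key₁ {X Y : Type*} {n : ℕ} (c : Code X Y n) (ω : (Fin n → X) × (Fin n → Y)) :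
    Fin c.numKey :=
  c.dec₁ (c.relay ω, ω.1)

/-- The key `K₂` of User 2, as a random variable on the source sequences. -/
def Code.key₂ {X Y : Type*} {n : ℕ} (c : Code X Y n) (ω : (Fin n → X) × (Fin n → Y)) :
    Fin c.numKey :=
  c.dec₂ (c.relay ω, ω.2)

/-- The pair `(Rc, Rk)` of nonnegative rates is achievable: for every `δ > 0` there is a sequence
of codes which, for all large `n`, has `Pr(K₁ ≠ K₂) ≤ δ`, broadcast rate at most `Rc + δ`, key
rate at least `Rk - δ` and leakage rate `I(K₁, K₂ ; W_c) / n` at most `δ`. -/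
def Achievable {X Y : Type*} [Fintype X] [Fintype Y] (p : X × Y → ℝ) (Rc Rk : ℝ) : Prop :=
  0 ≤ Rc ∧ 0 ≤ Rk ∧ ∀ δ : ℝ, 0 < δ → ∃ c : (n : ℕ) → Code X Y n, ∀ᶠ n : ℕ in Filter.atTop,
    prob (iidLaw p n) {ω | (c n).key₁ ω ≠ (c n).key₂ ω} ≤ δ ∧
    1 / (n : ℝ) * Real.logb 2 (c n).numMsg ≤ Rc + δ ∧
    Rk - δ ≤ 1 / (n : ℝ) * entropy (iidLaw p n) (c n).key₁ ∧
    1 / (n : ℝ) * mutualInfo (iidLaw p n) (fun ω => ((c n).key₁ ω, (c n).key₂ ω)) (c n).relay ≤ δ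

/-- The communication-key rate region: the closure of the set of achievable `(Rc, Rk)`. -/
def rateRegion {X Y : Type*} [Fintype X] [Fintype Y] (p : X × Y → ℝ) : Set (ℝ × ℝ) :=
  closure {r | Achievable p r.1 r.2}

end KeyRelay

/-! Converse. For a code put `U = (W_c, K₁)`. Since `K₁` is a function of `(W_c, Xⁿ)`, `H(U | Xⁿ)`
is at most `H(W_c)`, and Fano's inequality bounds `H(U | Yⁿ)` by the same up to a small multiple of
`n`. Small leakage gives `H(U) - H(W_c) ≥ H(K₁) - nδ`, so `I(U; Xⁿ)` and `I(U; Yⁿ)` are both nearly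
`n Rk` or more (`auxRates_of_code`). With `Q` a uniform time index, `V = (Q, U, X^{Q-1}, Y^{Q-1})`
turns all four bounds into single-letter ones (`auxRates_of_sequence`).

The four single-letter quantities depend on `V` only through `H(X | V)`, `H(Y | V)` and `H(X, Y |
V)`, and lowering `H(X | V)` with the other two fixed only helps. Reweighting the values of `V` is a
linear program: the law of `(X, Y)` and the two fixed entropies give `|X||Y| + 2` constraints, `H(X
| V)` is the objective, and a basic solution has at most that many values
(`exists_small_auxiliary`). With the alphabet of `V` bounded, the kernels range over finitely many
compact sets, so the set of supported rates is closed (`isClosed_auxRates`) and the slack can tend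
to zero.

Achievability. Draw `M K` codewords i.i.d. from `P_V^n` and arrange them in `M` bins of `K`. The
relay picks a codeword jointly typical with `(xⁿ, yⁿ)` and broadcasts its bin; each user looks in
the bin for a codeword with high information density against its own sequence, and the position in
the bin is the key. Covering needs `log(M K)` slightly above `n I(X,Y; V)`, decoding needs `log K`
slightly below `n min(I(X; V), I(Y; V))`, and the difference is the required broadcast rate because
`I(X; V | Y) = I(X,Y; V) - I(Y; V)` (`exists_codebook`, `exists_code`). Secrecy comes for free: a
fixed codeword is typical with a set of sources of probability at most about `2^{-n I(X,Y; V)}`, so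
`(W_c, K₁)` has no large atom off the failure event and its entropy is nearly `log(M K)`. Hence key
and message are nearly uniform and independent (`le_entropy_of_prob_inter_le`,
`exists_code_of_infoDensity`). -/

namespace KeyRelay

/-! ### Probability and entropy of finite random variables -/

section Basics

variable {Ω α β γ : Type*} [Fintype Ω] [Fintype α] [Fintype β] [Fintype γ] {q : Ω → ℝ}

lemma prob_eq_sum_ite (q : Ω → ℝ) (S : Set Ω) [DecidablePred (· ∈ S)] :
    prob q S = ∑ ω, if ω ∈ S then q ω else 0 := by
  unfold prob
  refine Finset.sum_congr rfl fun ω _ => ?_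
  by_cases h : ω ∈ S <;> simp [h]

lemma prob_nonneg (hq : ∀ ω, 0 ≤ q ω) (S : Set Ω) : 0 ≤ prob q S :=
  Finset.sum_nonneg fun ω _ => Set.indicator_nonneg (fun ω _ => hq ω) ω

lemma prob_mono (hq : ∀ ω, 0 ≤ q ω) {S T : Set Ω} (h : S ⊆ T) : prob q S ≤ prob q T :=
  Finset.sum_le_sum fun ω _ => Set.indicator_le_indicator_of_subset h hq ω

lemma prob_univ (q : Ω → ℝ) : prob q Set.univ = ∑ ω, q ω := by
  simp [prob]

lemma prob_le_one (hq : q ∈ stdSimplex ℝ Ω) (S : Set Ω) : prob q S ≤ 1 := by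
  rw [← hq.2, ← prob_univ]
  exact prob_mono hq.1 (Set.subset_univ S)

lemma prob_union_le (hq : ∀ ω, 0 ≤ q ω) (S T : Set Ω) :
    prob q (S ∪ T) ≤ prob q S + prob q T := by
  classical
  simp only [prob_eq_sum_ite, ← Finset.sum_add_distrib]
  refine Finset.sum_le_sum fun ω _ => ?_
  have := hq ω
  by_cases h1 : ω ∈ S <;> by_cases h2 : ω ∈ T <;> simp [h1, h2, this]

lemma prob_add_prob_compl (q : Ω → ℝ) (S : Set Ω) : prob q S + prob q Sᶜ = ∑ ω, q ω := by
  classical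
  simp only [prob_eq_sum_ite, ← Finset.sum_add_distrib]
  refine Finset.sum_congr rfl fun ω _ => ?_
  by_cases h : ω ∈ S <;> simp [h]

lemma le_prob_of_mem (hq : ∀ ω, 0 ≤ q ω) {S : Set Ω} {ω : Ω} (h : ω ∈ S) : q ω ≤ prob q S := by
  have := Finset.single_le_sum (f := fun ω => S.indicator q ω)
    (fun ω _ => Set.indicator_nonneg (fun ω _ => hq ω) ω) (Finset.mem_univ ω)
  simpa [prob, h] using this

lemma sum_mul_comp (q : Ω → ℝ) (A : Ω → α) (f : α → ℝ) :
    ∑ ω, q ω * f (A ω) = ∑ a, prob q {ω | A ω = a} * f a := by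
  classical
  simp only [prob_eq_sum_ite, Finset.sum_mul]
  rw [Finset.sum_comm]
  refine Finset.sum_congr rfl fun ω _ => ?_
  simp [ite_mul]

lemma sum_prob_fiber (q : Ω → ℝ) (A : Ω → α) : ∑ a, prob q {ω | A ω = a} = ∑ ω, q ω := by
  simpa using (sum_mul_comp q A (fun _ => 1)).symm

/-- Averaging over `Ω` instead of over values lets variables with different ranges be compared
pointwise. -/
lemma entropy_mul_log_two (q : Ω → ℝ) (A : Ω → α) :
    entropy q A * Real.log 2 = - ∑ ω, q ω * Real.log (prob q {ω' | A ω' = A ω}) := by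
  have h2 : Real.log 2 ≠ 0 := (Real.log_pos one_lt_two).ne'
  rw [sum_mul_comp q A (fun a => Real.log (prob q {ω' | A ω' = a}))]
  simp only [entropy, Finset.sum_mul, div_mul_cancel₀ _ h2, ← Finset.sum_neg_distrib,
    Real.negMulLog, neg_mul]

lemma entropy_mono (hq : ∀ ω, 0 ≤ q ω) {A : Ω → α} {B : Ω → β}
    (h : ∀ ω ω', B ω = B ω' → A ω = A ω') : entropy q A ≤ entropy q B := by
  have h2 : 0 < Real.log 2 := Real.log_pos one_lt_two
  refine le_of_mul_le_mul_right ?_ h2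
  rw [entropy_mul_log_two, entropy_mul_log_two, neg_le_neg_iff]
  refine Finset.sum_le_sum fun ω _ => ?_
  rcases (hq ω).eq_or_lt with h0 | h0
  · simp [← h0]
  · refine mul_le_mul_of_nonneg_left (Real.log_le_log ?_ (prob_mono hq fun ω' h' => h _ _ h'))
      h0.le
    exact h0.trans_le (le_prob_of_mem hq (by simp))

lemma entropy_congr (hq : ∀ ω, 0 ≤ q ω) {A : Ω → α} {B : Ω → β}
    (h : ∀ ω ω', A ω = A ω' ↔ B ω = B ω') : entropy q A = entropy q B :=
  le_antisymm (entropy_mono hq fun ω ω' => (h ω ω').2) (entropy_mono hq fun ω ω' => (h ω ω').1)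

lemma entropy_of_const (hq : q ∈ stdSimplex ℝ Ω) {A : Ω → α} (h : ∀ ω ω', A ω = A ω') :
    entropy q A = 0 := by
  have h2 : Real.log 2 ≠ 0 := (Real.log_pos one_lt_two).ne'
  have := entropy_mul_log_two q A
  have hs : ∀ ω, {ω' | A ω' = A ω} = Set.univ := fun ω => by ext ω'; simp [h ω' ω]
  simpa [hs, prob_univ, hq.2, h2] using this

lemma entropy_nonneg (hq : q ∈ stdSimplex ℝ Ω) (A : Ω → α) : 0 ≤ entropy q A := by
  rw [← entropy_of_const hq (A := fun _ => ()) (fun _ _ => rfl)]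
  exact entropy_mono hq.1 fun _ _ _ => rfl

/-- Gibbs' inequality for conditional entropy. -/
theorem condEntropy_mul_log_two_le (hq : q ∈ stdSimplex ℝ Ω) (A : Ω → α) (C : Ω → γ)
    (r : α → γ → ℝ) (hr0 : ∀ a c, 0 ≤ r a c) (hr1 : ∀ c, ∑ a, r a c ≤ 1)
    (hpos : ∀ ω, 0 < q ω → 0 < r (A ω) (C ω)) :
    condEntropy q A C * Real.log 2 ≤ - ∑ ω, q ω * Real.log (r (A ω) (C ω)) := by
  set P : α × γ → ℝ := fun s => prob q {ω | (A ω, C ω) = s} with hP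
  set R : γ → ℝ := fun c => prob q {ω | C ω = c} with hR
  -- This is `log t ≤ t - 1` at `t = R r / P`, weighted by `q ω` so that atoms of mass zero need no
  -- positivity.
  have key : ∀ ω, q ω * (1 - R (C ω) * r (A ω) (C ω) / P (A ω, C ω)) ≤
      q ω * Real.log (P (A ω, C ω)) - q ω * Real.log (R (C ω))
        - q ω * Real.log (r (A ω) (C ω)) := by
    intro ω
    rcases (hq.1 ω).eq_or_lt with h0 | h0
    · simp [← h0]
    have hP0 : 0 < P (A ω, C ω) := h0.trans_le (le_prob_of_mem hq.1 (by simp))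
    have hR0 : 0 < R (C ω) := h0.trans_le (le_prob_of_mem hq.1 (by simp))
    have hr := hpos ω h0
    rw [← mul_sub, ← mul_sub]
    refine mul_le_mul_of_nonneg_left ?_ h0.le
    have := Real.log_le_sub_one_of_pos (x := R (C ω) * r (A ω) (C ω) / P (A ω, C ω)) (by positivity)
    rw [Real.log_div (by positivity) hP0.ne', Real.log_mul hR0.ne' hr.ne'] at this
    linarith
  have hsum : ∑ ω, q ω * (R (C ω) * r (A ω) (C ω) / P (A ω, C ω)) ≤ 1 := by
    rw [sum_mul_comp q (fun ω => (A ω, C ω)) (fun s => R s.2 * r s.1 s.2 / P s)]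
    calc ∑ s : α × γ, P s * (R s.2 * r s.1 s.2 / P s) ≤ ∑ s : α × γ, R s.2 * r s.1 s.2 := by
          refine Finset.sum_le_sum fun s _ => ?_
          have h1 : 0 ≤ R s.2 * r s.1 s.2 := mul_nonneg (prob_nonneg hq.1 _) (hr0 _ _)
          by_cases h : P s = 0
          · simpa [h] using h1
          · rw [mul_div_cancel₀ _ h]
      _ = ∑ c, R c * ∑ a, r a c := by
          rw [Fintype.sum_prod_type_right]
          simp only [Finset.mul_sum]
      _ ≤ ∑ c, R c * 1 := Finset.sum_le_sum fun c _ =>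
          mul_le_mul_of_nonneg_left (hr1 c) (prob_nonneg hq.1 _)
      _ = 1 := by simp only [mul_one, hR, sum_prob_fiber, hq.2]
  have := Finset.sum_le_sum fun ω (_ : ω ∈ Finset.univ) => key ω
  simp only [mul_sub, mul_one, Finset.sum_sub_distrib, hq.2] at this
  rw [condEntropy, sub_mul, entropy_mul_log_two, entropy_mul_log_two]
  simp only [hP, hR] at this hsum
  linarith

/-- Gibbs' inequality with the test kernel `P(A = a | C = c)`, which ignores `B`. Where `P(C = c) =
0` the quotient is `0`, which is harmless because the kernel may be subnormalised. -/
lemma condEntropy_prod_le (hq : q ∈ stdSimplex ℝ Ω) (A : Ω → α) (B : Ω → β) (C : Ω → γ) :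
    condEntropy q A (fun ω => (B ω, C ω)) ≤ condEntropy q A C := by
  have h2 : 0 < Real.log 2 := Real.log_pos one_lt_two
  refine le_of_mul_le_mul_right ?_ h2
  have h := condEntropy_mul_log_two_le hq A (fun ω => (B ω, C ω))
    (fun a c => prob q {ω | (A ω, C ω) = (a, c.2)} / prob q {ω | C ω = c.2})
    (fun a c => div_nonneg (prob_nonneg hq.1 _) (prob_nonneg hq.1 _)) ?_ ?_
  · refine h.trans (le_of_eq ?_)
    rw [condEntropy, sub_mul, entropy_mul_log_two, entropy_mul_log_two, sub_neg_eq_add,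
      ← sub_eq_neg_add, ← Finset.sum_sub_distrib, ← Finset.sum_neg_distrib]
    refine Finset.sum_congr rfl fun ω _ => ?_
    rcases (hq.1 ω).eq_or_lt with h0 | h0
    · simp [← h0]
    · rw [Real.log_div (h0.trans_le (le_prob_of_mem hq.1 (by simp))).ne'
        (h0.trans_le (le_prob_of_mem hq.1 (by simp))).ne']
      ring
  · rintro ⟨b, c⟩
    rw [← Finset.sum_div]
    refine div_le_one_of_le₀ (le_of_eq ?_) (prob_nonneg hq.1 _)
    classical
    simp only [prob_eq_sum_ite, Set.mem_ofPred_eq, Prod.mk.injEq]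
    rw [Finset.sum_comm]
    refine Finset.sum_congr rfl fun ω _ => ?_
    by_cases h : C ω = c <;> simp [h]
  · intro ω h0
    exact div_pos (h0.trans_le (le_prob_of_mem hq.1 (by simp)))
      (h0.trans_le (le_prob_of_mem hq.1 (by simp)))

lemma condEntropy_anti (hq : q ∈ stdSimplex ℝ Ω) (A : Ω → α) {B : Ω → β} {C : Ω → γ}
    (h : ∀ ω ω', B ω = B ω' → C ω = C ω') : condEntropy q A B ≤ condEntropy q A C := by
  refine le_trans (le_of_eq ?_) (condEntropy_prod_le hq A B C)
  rw [condEntropy, condEntropy]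
  congr 1 <;> refine entropy_congr hq.1 fun ω ω' => ?_ <;> simp only [Prod.mk.injEq]
  · exact ⟨fun k => ⟨k.1, k.2, h _ _ k.2⟩, fun k => ⟨k.1, k.2.1⟩⟩
  · exact ⟨fun k => ⟨k, h _ _ k⟩, fun k => k.1⟩

lemma condEntropy_le_entropy (hq : q ∈ stdSimplex ℝ Ω) (A : Ω → α) (C : Ω → γ) :
    condEntropy q A C ≤ entropy q A := by
  refine (condEntropy_anti hq A (C := fun _ => ()) fun _ _ _ => rfl).trans (le_of_eq ?_)
  rw [condEntropy, entropy_of_const hq (A := fun _ => ()) fun _ _ => rfl, sub_zero]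
  exact entropy_congr hq.1 fun _ _ => by simp

lemma entropy_prod_le (hq : q ∈ stdSimplex ℝ Ω) (A : Ω → α) (B : Ω → β) :
    entropy q (fun ω => (A ω, B ω)) ≤ entropy q A + entropy q B := by
  have := condEntropy_le_entropy hq A B
  rw [condEntropy] at this
  linarith

lemma entropy_prod_comm (hq : ∀ ω, 0 ≤ q ω) (A : Ω → α) (B : Ω → β) :
    entropy q (fun ω => (A ω, B ω)) = entropy q (fun ω => (B ω, A ω)) :=
  entropy_congr hq fun _ _ => by simp [and_comm]

lemma mutualInfo_nonneg (hq : q ∈ stdSimplex ℝ Ω) (A : Ω → α) (B : Ω → β) :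
    0 ≤ mutualInfo q A B :=
  sub_nonneg.2 (condEntropy_le_entropy hq A B)

lemma entropy_le_logb_card (hq : q ∈ stdSimplex ℝ Ω) (A : Ω → α) :
    entropy q A ≤ Real.logb 2 (Fintype.card α) := by
  have h2 : 0 < Real.log 2 := Real.log_pos one_lt_two
  have hc : condEntropy q A (fun _ => ()) = entropy q A := by
    rw [condEntropy, entropy_of_const hq (A := fun _ => ()) fun _ _ => rfl, sub_zero]
    exact entropy_congr hq.1 fun _ _ => by simp
  rw [Real.logb, le_div_iff₀ h2, ← hc]
  refine (condEntropy_mul_log_two_le hq A (fun _ => ()) (fun _ _ => (Fintype.card α : ℝ)⁻¹)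
    (fun _ _ => by positivity) ?_ ?_).trans (le_of_eq ?_)
  · intro _
    simp only [Finset.sum_const, Finset.card_univ, nsmul_eq_mul]
    exact mul_inv_le_one
  · intro ω _
    have : 0 < Fintype.card α := Fintype.card_pos_iff.2 ⟨A ω⟩
    positivity
  · rw [← Finset.sum_mul, hq.2, Real.log_inv]
    ring

/-- Fano's inequality; only the number of values that `A` takes matters. -/
theorem condEntropy_le_fano (hq : q ∈ stdSimplex ℝ Ω) (A B : Ω → α) (S : Finset α)
    (hS : ∀ ω, A ω ∈ S) {N : ℝ} (hN : 0 < N) (hSN : (S.card : ℝ) ≤ N) :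
    condEntropy q A B ≤ 1 + prob q {ω | A ω ≠ B ω} * Real.logb 2 N := by
  classical
  have h2 : 0 < Real.log 2 := Real.log_pos one_lt_two
  refine le_of_mul_le_mul_right ?_ h2
  refine (condEntropy_mul_log_two_le hq A B
    -- The guess `b` gets mass `1/2` and the other half is spread over `S`: an atom costs one bit
    -- when the guess is right and `1 + log N` bits otherwise.
    (fun a b => (if a = b then 2⁻¹ else 0) + if a ∈ S ∧ a ≠ b then (2 * N)⁻¹ else 0)
    (fun a b => by positivity) ?_ ?_).trans (le_of_eq ?_)
  · intro b
    rw [Finset.sum_add_distrib]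
    have h1 : ∑ a, (if a = b then (2⁻¹ : ℝ) else 0) = 2⁻¹ := by simp
    have h3 : ∑ a, (if a ∈ S ∧ a ≠ b then (2 * N)⁻¹ else 0) ≤ 2⁻¹ := by
      calc ∑ a, (if a ∈ S ∧ a ≠ b then (2 * N)⁻¹ else 0)
          ≤ ∑ a, (if a ∈ S then (2 * N)⁻¹ else 0) := by
            refine Finset.sum_le_sum fun a _ => ?_
            split_ifs with h h' h'
            · rfl
            · exact absurd h.1 h'
            · positivity
            · rfl
        _ = S.card * (2 * N)⁻¹ := by simp [Finset.sum_ite_mem]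
        _ ≤ N * (2 * N)⁻¹ := mul_le_mul_of_nonneg_right hSN (by positivity)
        _ = 2⁻¹ := by field_simp
    linarith
  · intro ω _
    by_cases h : A ω = B ω
    · simp [h]
    · simp [h, hS ω, hN]
  · have hlog : Real.logb 2 N * Real.log 2 = Real.log N := div_mul_cancel₀ _ h2.ne'
    rw [add_mul, mul_assoc, hlog, prob_eq_sum_ite, one_mul, Finset.sum_mul]
    have h3 : Real.log 2 = ∑ ω, q ω * Real.log 2 := by rw [← Finset.sum_mul, hq.2, one_mul]
    rw [h3, ← Finset.sum_add_distrib, ← Finset.sum_neg_distrib]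
    refine Finset.sum_congr rfl fun ω _ => ?_
    by_cases h : A ω = B ω
    · simp [h]
    · simp only [h, if_false, hS ω, ne_eq, not_false_eq_true, and_self, if_true, zero_add,
        Real.log_inv, Real.log_mul two_ne_zero hN.ne', Set.mem_ofPred_eq]
      ring

/-- A variable whose restriction to an event of probability `1 - η` has no large atom has large
entropy. -/
theorem le_entropy_of_prob_inter_le (hq : q ∈ stdSimplex ℝ Ω) (A : Ω → α) (G : Set Ω) {b η : ℝ}
    (hb : 0 < b) (hG : prob q Gᶜ ≤ η) (hA : ∀ a, prob q ({ω | A ω = a} ∩ G) ≤ b) (hb1 : b ≤ 1) :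
    -(1 - η) * Real.log b - η ≤ entropy q A * Real.log 2 := by
  classical
  have hG' : 1 - η ≤ prob q G := by
    have := prob_add_prob_compl q G
    rw [hq.2] at this
    linarith
  set P : α → ℝ := fun a => prob q {ω | A ω = a}
  set D : α → ℝ := fun a => prob q ({ω | A ω = a} ∩ G)
  have hD : ∑ a, D a = prob q G := by
    have := sum_prob_fiber (fun ω => G.indicator q ω) A
    refine Eq.trans (Finset.sum_congr rfl fun a _ => ?_) this
    simp only [D, prob, Set.indicator_indicator]
  -- As `D ≤ P ≤ 1`, `-P log P ≥ -D log P ≥ -D log D - (P - D)`, and `D ≤ b`. The corrections `P -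
  -- D` sum to at most `η`.
  have key : ∀ a, D a * (-Real.log b) + (D a - P a) ≤ Real.negMulLog (P a) := by
    intro a
    have hDP : D a ≤ P a := prob_mono hq.1 Set.inter_subset_left
    have hD0 : 0 ≤ D a := prob_nonneg hq.1 _
    have hP1 : P a ≤ 1 := prob_le_one hq _
    have hlogP : Real.log (P a) ≤ 0 := Real.log_nonpos (hD0.trans hDP) hP1
    rcases hD0.eq_or_lt with h0 | h0
    · rw [← h0, Real.negMulLog]
      nlinarith
    · have hP0 := h0.trans_le hDP
      have h1 : Real.log (D a) ≤ Real.log b := Real.log_le_log h0 (hA a)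
      have h2 := Real.log_le_sub_one_of_pos (x := P a / D a) (by positivity)
      rw [Real.log_div hP0.ne' h0.ne'] at h2
      have h3 : D a * (P a / D a - 1) = P a - D a := by field_simp
      have h4 : D a * (Real.log (P a) - Real.log (D a)) ≤ P a - D a := by
        rw [← h3]; exact mul_le_mul_of_nonneg_left h2 h0.le
      rw [Real.negMulLog]
      nlinarith
  have h2 : Real.log 2 ≠ 0 := (Real.log_pos one_lt_two).ne'
  have hsum := Finset.sum_le_sum fun a (_ : a ∈ Finset.univ) => key a
  rw [Finset.sum_add_distrib, ← Finset.sum_mul, Finset.sum_sub_distrib, hD, sum_prob_fiber,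
    hq.2] at hsum
  simp only [entropy, Finset.sum_mul, div_mul_cancel₀ _ h2]
  have := Real.log_nonpos hb.le hb1
  nlinarith

end Basics

/-! ### Transport along a random variable with a given law -/

section Maps

variable {Ω Ω' α : Type*} [Fintype Ω] [Fintype Ω'] [Fintype α]

lemma prob_of_law {q : Ω → ℝ} {q' : Ω' → ℝ} {Z : Ω → Ω'}
    (h : ∀ z, prob q {ω | Z ω = z} = q' z) (S : Set Ω') : prob q (Z ⁻¹' S) = prob q' S := by
  classical
  have := sum_mul_comp q Z (S.indicator 1)
  simp only [h] at this
  simp only [prob_eq_sum_ite]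
  simpa [Set.indicator_apply] using this

lemma entropy_of_law {q : Ω → ℝ} {q' : Ω' → ℝ} {Z : Ω → Ω'}
    (h : ∀ z, prob q {ω | Z ω = z} = q' z) (A : Ω' → α) :
    entropy q (fun ω => A (Z ω)) = entropy q' A := by
  simp only [entropy]
  refine Finset.sum_congr rfl fun a _ => ?_
  rw [← prob_of_law h]
  rfl

end Maps

/-! ### Independent and identically distributed pairs -/

section Iid

variable {X Y : Type*} [Fintype X] [Fintype Y] {n : ℕ}

lemma sum_prod_coords (g : Fin n → X × Y → ℝ) :
    ∑ ω : (Fin n → X) × (Fin n → Y), ∏ i, g i (ω.1 i, ω.2 i) = ∏ i, ∑ z, g i z := by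
  classical
  rw [Finset.prod_univ_sum, Fintype.piFinset_univ,
    ← (Equiv.arrowProdEquivProdArrow (Fin n) (fun _ => X) (fun _ => Y)).sum_comp]
  rfl

variable {p : X × Y → ℝ}

lemma iidLaw_mem_stdSimplex (hp : p ∈ stdSimplex ℝ (X × Y)) (n : ℕ) :
    iidLaw p n ∈ stdSimplex ℝ ((Fin n → X) × (Fin n → Y)) := by
  refine ⟨fun ω => Finset.prod_nonneg fun i _ => hp.1 _, ?_⟩
  simp only [iidLaw]
  rw [sum_prod_coords (fun _ => p)]
  simp [hp.2]

lemma sum_iidLaw_mul_coord (hp : p ∈ stdSimplex ℝ (X × Y)) (i : Fin n) (f : X × Y → ℝ) :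
    ∑ ω, iidLaw p n ω * f (ω.1 i, ω.2 i) = ∑ z, p z * f z := by
  have := sum_prod_coords (n := n) fun j z => p z * if j = i then f z else 1
  simp only [Finset.prod_mul_distrib, Finset.prod_ite_eq', Finset.mem_univ, if_true] at this
  rw [← Finset.mul_prod_erase _ _ (Finset.mem_univ i)] at this
  simp only [if_true] at this
  rw [show ∑ z, p z * f z = (∑ z, p z * f z) * 1 by ring]
  rw [Finset.prod_eq_one] at this
  · exact this
  · intro j hj
    simp [Finset.ne_of_mem_erase hj, hp.2]

lemma sum_iidLaw_mul_coord_mul_coord (hp : p ∈ stdSimplex ℝ (X × Y)) {i j : Fin n} (hij : i ≠ j)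
    (f g : X × Y → ℝ) :
    ∑ ω, iidLaw p n ω * (f (ω.1 i, ω.2 i) * g (ω.1 j, ω.2 j)) =
      (∑ z, p z * f z) * ∑ z, p z * g z := by
  have := sum_prod_coords (n := n) fun k z =>
    p z * ((if k = i then f z else 1) * if k = j then g z else 1)
  simp only [Finset.prod_mul_distrib, Finset.prod_ite_eq', Finset.mem_univ, if_true] at this
  rw [← Finset.mul_prod_erase _ _ (Finset.mem_univ i),
    ← Finset.mul_prod_erase _ _ (Finset.mem_erase.2 ⟨hij.symm, Finset.mem_univ j⟩)] at this
  simp only [if_true, hij, hij.symm, if_false, mul_one, one_mul] at this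
  rw [Finset.prod_eq_one, mul_one] at this
  · exact this
  · intro k hk
    rw [Finset.mem_erase, Finset.mem_erase] at hk
    simp [hk.1, hk.2.1, hp.2]

lemma iidLaw_coord_law (hp : p ∈ stdSimplex ℝ (X × Y)) (i : Fin n) (z : X × Y) :
    prob (iidLaw p n) {ω | (ω.1 i, ω.2 i) = z} = p z := by
  classical
  have := sum_iidLaw_mul_coord hp i (fun z' => if z' = z then 1 else 0)
  simpa [prob_eq_sum_ite] using this

lemma entropy_iidLaw_coord (hp : p ∈ stdSimplex ℝ (X × Y)) {α : Type*} [Fintype α]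
    (A : X × Y → α) (i : Fin n) :
    entropy (iidLaw p n) (fun ω => A (ω.1 i, ω.2 i)) = entropy p A :=
  entropy_of_law (iidLaw_coord_law hp i) A

lemma prob_setOf_eq {Ω : Type*} [Fintype Ω] (q : Ω → ℝ) (ω : Ω) : prob q {ω' | ω' = ω} = q ω := by
  classical
  simp [prob_eq_sum_ite]

lemma entropy_iidLaw (hp : p ∈ stdSimplex ℝ (X × Y)) (n : ℕ) :
    entropy (iidLaw p n) (fun ω => ω) = n * entropy p (fun z => z) := by
  have h2 : Real.log 2 ≠ 0 := (Real.log_pos one_lt_two).ne'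
  refine mul_right_cancel₀ h2 ?_
  rw [mul_assoc, entropy_mul_log_two, entropy_mul_log_two]
  simp only [prob_setOf_eq]
  have : ∀ ω, iidLaw p n ω * Real.log (iidLaw p n ω) =
      ∑ i, iidLaw p n ω * Real.log (p (ω.1 i, ω.2 i)) := by
    intro ω
    by_cases h : iidLaw p n ω = 0
    · simp [h]
    · rw [← Finset.mul_sum]
      congr 1
      exact Real.log_prod fun i _ hi => h (Finset.prod_eq_zero (Finset.mem_univ i) hi)
  simp only [this]
  rw [Finset.sum_comm]
  simp only [sum_iidLaw_mul_coord hp _ fun z => Real.log (p z)]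
  simp

/-- Chebyshev's inequality for i.i.d. sums. -/
theorem prob_iidLaw_deviation_le (hp : p ∈ stdSimplex ℝ (X × Y)) (f : X × Y → ℝ) {ε : ℝ}
    (hε : 0 < ε) (hn : 0 < n) :
    prob (iidLaw p n) {ω | n * ε < |∑ i, f (ω.1 i, ω.2 i) - n * ∑ z, p z * f z|} ≤
      (∑ z, p z * (f z - ∑ z, p z * f z) ^ 2) / (n * ε ^ 2) := by
  classical
  set μ := ∑ z, p z * f z with hμ
  have hn' : (0 : ℝ) < n := by exact_mod_cast hn
  have hq := iidLaw_mem_stdSimplex hp n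
  set g : X × Y → ℝ := fun z => f z - μ with hg
  have hg0 : ∑ z, p z * g z = 0 := by
    simp only [hg, mul_sub, Finset.sum_sub_distrib, ← Finset.sum_mul, hp.2, ← hμ]
    ring
  have hsum : ∀ ω : (Fin n → X) × (Fin n → Y),
      ∑ i, f (ω.1 i, ω.2 i) - n * μ = ∑ i, g (ω.1 i, ω.2 i) := by
    intro ω
    simp [hg]
  have hvar : ∑ ω, iidLaw p n ω * (∑ i, g (ω.1 i, ω.2 i)) ^ 2 = n * ∑ z, p z * g z ^ 2 := by
    simp only [sq (∑ i, g _), Finset.sum_mul_sum]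
    simp only [Finset.mul_sum]
    rw [Finset.sum_comm]
    have : ∀ i : Fin n, ∑ ω, ∑ j, iidLaw p n ω * (g (ω.1 i, ω.2 i) * g (ω.1 j, ω.2 j)) =
        ∑ z, p z * (g z * g z) := by
      intro i
      rw [Finset.sum_comm, Finset.sum_eq_single i]
      · exact sum_iidLaw_mul_coord hp i fun z => g z * g z
      · intro j _ hj
        rw [sum_iidLaw_mul_coord_mul_coord hp hj.symm, hg0, zero_mul]
      · simp
    simp only [this, ← sq]
    simp [Finset.mul_sum]
  rw [le_div_iff₀ (by positivity)]
  refine le_of_mul_le_mul_left ?_ hn'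
  rw [← hvar, prob_eq_sum_ite, Finset.sum_mul, Finset.mul_sum]
  refine Finset.sum_le_sum fun ω _ => ?_
  have h0 := hq.1 ω
  simp only [Set.mem_ofPred_eq, hsum]
  split_ifs with h
  · have : (n * ε) ^ 2 ≤ (∑ i, g (ω.1 i, ω.2 i)) ^ 2 := by
      rw [← sq_abs (∑ i, g (ω.1 i, ω.2 i))]
      exact pow_le_pow_left₀ (by positivity) h.le 2
    calc (n : ℝ) * (iidLaw p n ω * (n * ε ^ 2)) = iidLaw p n ω * (n * ε) ^ 2 := by ring
      _ ≤ _ := mul_le_mul_of_nonneg_left this h0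
  · simp only [zero_mul, mul_zero]
    positivity

end Iid

/-! ### The chain rule for sequences -/

section Chain

variable {α : Type*} {n : ℕ}

/-- The coordinates with index below `k`, the others being hidden. -/
def mask (k : ℕ) (x : Fin n → α) : Fin n → Option α :=
  fun j => if (j : ℕ) < k then some (x j) else none

lemma mask_eq_iff {k : ℕ} {x y : Fin n → α} :
    mask k x = mask k y ↔ ∀ j : Fin n, (j : ℕ) < k → x j = y j := by
  constructor
  · intro h j hj
    simpa [mask, hj] using congrFun h j
  · intro h
    funext j
    by_cases hj : (j : ℕ) < k
    · simp [mask, hj, h j hj]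
    · simp [mask, hj]

lemma mask_succ_eq_iff {i : Fin n} {x y : Fin n → α} :
    mask ((i : ℕ) + 1) x = mask ((i : ℕ) + 1) y ↔ x i = y i ∧ mask i x = mask i y := by
  simp only [mask_eq_iff, Nat.lt_succ_iff_lt_or_eq]
  constructor
  · exact fun h => ⟨h i (Or.inr rfl), fun j hj => h j (Or.inl hj)⟩
  · rintro ⟨h1, h2⟩ j (hj | hj)
    · exact h2 j hj
    · rw [Fin.ext hj]; exact h1

variable {Ω τ : Type*} [Fintype Ω] [Fintype α] [Fintype τ] {q : Ω → ℝ}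

/-- The chain rule `H(T, Fⁿ) - H(T) = ∑ i, H(F i | T, F^{i-1})`. -/
theorem entropy_chain (hq : ∀ ω, 0 ≤ q ω) (T : Ω → τ) (F : Ω → Fin n → α) :
    entropy q (fun ω => (T ω, F ω)) - entropy q T =
      ∑ i : Fin n, condEntropy q (fun ω => F ω i) (fun ω => (T ω, mask i (F ω))) := by
  have h1 : entropy q (fun ω => (T ω, F ω)) = entropy q (fun ω => (T ω, mask n (F ω))) :=
    entropy_congr hq fun ω ω' => by
      simp only [Prod.mk.injEq, mask_eq_iff, Fin.is_lt, true_imp_iff]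
      rw [funext_iff]
  have h0 : entropy q T = entropy q (fun ω => (T ω, mask 0 (F ω))) :=
    entropy_congr hq fun ω ω' => by simp [mask_eq_iff]
  -- The sum telescopes between `mask 0`, which hides everything, and `mask n`, which hides nothing.
  rw [h1, h0, ← Finset.sum_range_sub (fun k => entropy q (fun ω => (T ω, mask k (F ω)))),
    Finset.sum_range]
  refine Finset.sum_congr rfl fun i _ => ?_
  rw [condEntropy]
  congr 1
  exact entropy_congr hq fun ω ω' => by
    simp only [Prod.mk.injEq, mask_succ_eq_iff]
    tauto

end Chain

/-! ### A uniform time index -/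

section TimeSharing

variable {Ω α β : Type*} [Fintype Ω] [Fintype α] [Fintype β] {q : Ω → ℝ} {n : ℕ}

/-- The law of `(Q, ω)` with `Q` uniform on `Fin n` and independent of `ω`. -/
noncomputable def uniformProd (q : Ω → ℝ) (n : ℕ) : Fin n × Ω → ℝ := fun s => q s.2 / n

lemma uniformProd_mem_stdSimplex (hq : q ∈ stdSimplex ℝ Ω) (hn : 0 < n) :
    uniformProd q n ∈ stdSimplex ℝ (Fin n × Ω) := by
  have hn' : (n : ℝ) ≠ 0 := by exact_mod_cast hn.ne'
  refine ⟨fun s => div_nonneg (hq.1 _) (Nat.cast_nonneg n), ?_⟩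
  rw [Fintype.sum_prod_type]
  simp [uniformProd, ← Finset.sum_div, hq.2, hn']

lemma prob_uniformProd_fst (q : Ω → ℝ) (i : Fin n) (S : Set (Fin n × Ω)) (hS : ∀ s ∈ S, s.1 = i) :
    prob (uniformProd q n) S = prob q {ω | (i, ω) ∈ S} / n := by
  classical
  simp only [prob_eq_sum_ite, uniformProd, Fintype.sum_prod_type, Finset.sum_div]
  rw [Finset.sum_eq_single i]
  · refine Finset.sum_congr rfl fun ω _ => ?_
    by_cases h : (i, ω) ∈ S <;> simp [h]
  · intro j _ hj
    refine Finset.sum_eq_zero fun ω _ => if_neg fun h => hj (hS _ h)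
  · simp

/-- The index contributes `log n` and, given the index, the entropies average. In conditional
entropies the `log n` cancels. -/
lemma entropy_uniformProd (hq : q ∈ stdSimplex ℝ Ω) (hn : 0 < n) (A : Fin n × Ω → α) :
    entropy (uniformProd q n) (fun s => (s.1, A s)) * Real.log 2 =
      Real.log n + (∑ i, entropy q (fun ω => A (i, ω))) / n * Real.log 2 := by
  have hn' : (n : ℝ) ≠ 0 := by exact_mod_cast hn.ne'
  rw [entropy_mul_log_two, Finset.sum_div, Finset.sum_mul, Fintype.sum_prod_type]
  have key : ∀ i : Fin n, ∑ ω, uniformProd q n (i, ω) * Real.log (prob (uniformProd q n)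
      {s' | (s'.1, A s') = (i, A (i, ω))}) =
      -(entropy q (fun ω => A (i, ω)) / n * Real.log 2) - Real.log n / n := by
    intro i
    rw [div_mul_eq_mul_div, entropy_mul_log_two, neg_div, neg_neg, Finset.sum_div]
    rw [show Real.log n / n = ∑ ω, q ω * Real.log n / n by
      rw [← Finset.sum_div, ← Finset.sum_mul, hq.2, one_mul], ← Finset.sum_sub_distrib]
    refine Finset.sum_congr rfl fun ω _ => ?_
    rw [prob_uniformProd_fst q i _ (by rintro ⟨a, b⟩ h; simpa using (Prod.mk.inj h).1)]
    simp only [Set.mem_ofPred_eq, Prod.mk.injEq, true_and, uniformProd]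
    rcases (hq.1 ω).eq_or_lt with h0 | h0
    · simp [← h0]
    rw [Real.log_div (h0.trans_le (le_prob_of_mem hq.1 (by simp))).ne' hn']
    ring
  simp only [key]
  rw [Finset.sum_sub_distrib, Finset.sum_neg_distrib]
  simp only [Finset.sum_const, Finset.card_univ, Fintype.card_fin, nsmul_eq_mul]
  simp only [← Finset.sum_div, ← Finset.sum_mul]
  field_simp
  ring

lemma condEntropy_uniformProd (hq : q ∈ stdSimplex ℝ Ω) (hn : 0 < n) (A : Fin n × Ω → α)
    (B : Fin n × Ω → β) :
    condEntropy (uniformProd q n) A (fun s => (s.1, B s)) =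
      (∑ i, condEntropy q (fun ω => A (i, ω)) (fun ω => B (i, ω))) / n := by
  have h2 : Real.log 2 ≠ 0 := (Real.log_pos one_lt_two).ne'
  have hq' := uniformProd_mem_stdSimplex hq hn
  refine mul_right_cancel₀ h2 ?_
  have e : entropy (uniformProd q n) (fun s => (A s, (s.1, B s))) =
      entropy (uniformProd q n) (fun s => (s.1, (A s, B s))) :=
    entropy_congr hq'.1 fun s s' => by simp only [Prod.mk.injEq]; tauto
  rw [condEntropy, e, sub_mul, entropy_uniformProd hq hn (fun s => (A s, B s)),
    entropy_uniformProd hq hn B]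
  simp only [condEntropy, Finset.sum_sub_distrib]
  ring

end TimeSharing

/-! ### Basic solutions and the support lemma -/

/-- A feasible point of a linear program whose feasible set is bounded can be replaced by a basic
one without increasing the objective. -/
theorem exists_basic_solution {β ι : Type*} [Fintype β] [Fintype ι] (a : β → ι → ℝ) (c : β → ℝ)
    (u : ι → ℝ) (t : β → ℝ) (ht : ∀ v, 0 ≤ t v) (hu : ∀ v, t v ≠ 0 → 0 < ∑ i, u i * a v i) :
    ∃ t' : β → ℝ, (∀ v, 0 ≤ t' v) ∧ (∀ i, ∑ v, t' v * a v i = ∑ v, t v * a v i) ∧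
      ∑ v, t' v * c v ≤ ∑ v, t v * c v ∧ Nat.card {v // t' v ≠ 0} ≤ Fintype.card ι := by
  classical
  induction hN : Nat.card {v // t v ≠ 0} using Nat.strong_induction_on generalizing t with
  | _ N ih =>
  by_cases hle : N ≤ Fintype.card ι
  · exact ⟨t, ht, fun _ => rfl, le_rfl, hN ▸ hle⟩
  -- More than `|ι|` vectors in `ℝ^ι` are dependent; a relation among the active rows is a direction
  -- that preserves every constraint.
  have hdep : ∃ d : β → ℝ, (∀ v, t v = 0 → d v = 0) ∧ (∀ i, ∑ v, d v * a v i = 0) ∧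
      ∃ v, d v ≠ 0 := by
    have hli : ¬ LinearIndependent ℝ (fun v : {v // t v ≠ 0} => a v) := by
      intro h
      have := h.fintype_card_le_finrank
      rw [Module.finrank_fintype_fun_eq_card, ← Nat.card_eq_fintype_card] at this
      omega
    obtain ⟨g, hg, ⟨v, hv⟩, hgv⟩ := Fintype.not_linearIndependent_iff.1 hli
    refine ⟨fun v => if h : t v ≠ 0 then g ⟨v, h⟩ else 0, fun v hv => by simp [hv], fun i => ?_,
      v, by simpa [hv] using hgv⟩
    have h1 := congrFun hg i
    simp only [Finset.sum_apply, Pi.smul_apply, smul_eq_mul, Pi.zero_apply] at h1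
    refine Eq.trans ?_ h1
    rw [← Finset.sum_filter_of_ne (p := fun v => t v ≠ 0)
      (fun v _ h => by by_contra h0; simp only [h0, dite_false, zero_mul, ne_eq, not_true] at h),
      Finset.sum_subtype (p := fun v => t v ≠ 0) (Finset.univ.filter fun v => t v ≠ 0) (by simp)]
    exact Finset.sum_congr rfl fun v _ => congrArg (· * a v i) (dif_pos v.2)
  obtain ⟨d, hd0, hd, v₁, hv₁, hdc⟩ : ∃ d : β → ℝ, (∀ v, t v = 0 → d v = 0) ∧
      (∀ i, ∑ v, d v * a v i = 0) ∧ ∃ v, d v ≠ 0 ∧ ∑ v, d v * c v ≤ 0 := by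
    obtain ⟨d, h1, h2, v, h3⟩ := hdep
    rcases le_total (∑ v, d v * c v) 0 with h | h
    · exact ⟨d, h1, h2, v, h3, h⟩
    · exact ⟨-d, fun v hv => by simp [h1 v hv], fun i => by simp [h2], v, by simpa using h3,
        by simpa using h⟩
  -- The combination `u` of the constraints is positive on the support, so it would be positive
  -- along a nonzero `d ≥ 0`, yet `d` annihilates every constraint.
  have hneg : ∃ v, d v < 0 := by
    by_contra! hcon
    have h0 : ∑ v, d v * ∑ i, u i * a v i = 0 := by
      simp only [Finset.mul_sum]
      rw [Finset.sum_comm]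
      refine Finset.sum_eq_zero fun i _ => ?_
      rw [← mul_zero (u i), ← hd i, Finset.mul_sum]
      exact Finset.sum_congr rfl fun v _ => by ring
    have hnn : ∀ v, 0 ≤ d v * ∑ i, u i * a v i := fun v => by
      by_cases h : t v = 0
      · simp [hd0 v h]
      · exact mul_nonneg (hcon v) (hu v h).le
    have := (Finset.sum_eq_zero_iff_of_nonneg fun v _ => hnn v).1 h0 v₁ (Finset.mem_univ _)
    have ht1 : t v₁ ≠ 0 := fun h => hv₁ (hd0 _ h)
    exact (mul_ne_zero hv₁ (hu v₁ ht1).ne') this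
  -- Ratio test: `v₀` is the first coordinate to vanish on moving along `d`.
  obtain ⟨v₀, hv₀, hmin⟩ := Finset.exists_min_image (Finset.univ.filter fun v => d v < 0)
    (fun v => t v / -d v) (by obtain ⟨v, hv⟩ := hneg; exact ⟨v, by simpa using hv⟩)
  simp only [Finset.mem_filter, Finset.mem_univ, true_and] at hv₀ hmin
  set s := t v₀ / -d v₀ with hs
  have hs0 : 0 ≤ s := div_nonneg (ht _) (by linarith)
  have hzero : t v₀ + s * d v₀ = 0 := by
    have : d v₀ ≠ 0 := hv₀.ne
    rw [hs]; field_simp; ring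
  have ht0 : t v₀ ≠ 0 := fun h => hv₀.ne (hd0 _ h)
  have hpos : ∀ v, 0 ≤ t v + s * d v := by
    intro v
    by_cases h : d v < 0
    · have := hmin v h
      rw [le_div_iff₀ (by linarith)] at this
      linarith
    · exact add_nonneg (ht v) (mul_nonneg hs0 (not_lt.1 h))
  have hsupp : ∀ v, t v + s * d v ≠ 0 → t v ≠ 0 := fun v h h' => h (by simp [h', hd0 v h'])
  have hcard : Nat.card {v // t v + s * d v ≠ 0} < N := by
    rw [← hN, Nat.card_eq_fintype_card, Nat.card_eq_fintype_card]
    exact Fintype.card_lt_of_injective_of_notMem (b := ⟨v₀, ht0⟩)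
      (fun v => (⟨v.1, hsupp v.1 v.2⟩ : {v // t v ≠ 0}))
      (fun v v' h => Subtype.ext (by simpa using h))
      (by rintro ⟨⟨v, hv⟩, h⟩; simp only [Subtype.mk.injEq] at h; exact hv (h ▸ hzero))
  obtain ⟨t', h1, h2, h3, h4⟩ := ih _ hcard (fun v => t v + s * d v) hpos
    (fun v hv => hu v (hsupp v hv)) rfl
  refine ⟨t', h1, fun i => ?_, h3.trans ?_, h4⟩
  · rw [h2]
    simp only [add_mul, Finset.sum_add_distrib, mul_assoc, ← Finset.mul_sum, hd, mul_zero, add_zero]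
  · simp only [add_mul, Finset.sum_add_distrib, mul_assoc, ← Finset.mul_sum]
    nlinarith

section Kernel

variable {Z α β : Type*} [Fintype Z] [Fintype α] [Fintype β]

/-- The contribution `P(V = v) H(A | V = v)`, in nats, of one value of `V` to `H(A | V)`, as a
function of the mass function `ρ = P(Z = ·, V = v)`. -/
noncomputable def condTerm (A : Z → α) (ρ : Z → ℝ) : ℝ :=
  ∑ a, Real.negMulLog (prob ρ {z | A z = a}) - Real.negMulLog (∑ z, ρ z)

lemma prob_const_mul (t : ℝ) (ρ : Z → ℝ) (S : Set Z) :
    prob (fun z => t * ρ z) S = t * prob ρ S := by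
  classical
  simp [prob_eq_sum_ite, Finset.mul_sum]

/-- The terms in `t log t` cancel because the fibre masses add up to the total mass. This
homogeneity makes conditional entropies linear in the weights given to the values of `V`. -/
lemma condTerm_const_mul (A : Z → α) (t : ℝ) (ρ : Z → ℝ) :
    condTerm A (fun z => t * ρ z) = t * condTerm A ρ := by
  simp only [condTerm, prob_const_mul, ← Finset.mul_sum, Real.negMulLog_mul,
    Finset.sum_add_distrib, ← Finset.sum_mul, sum_prob_fiber]
  ring

lemma condEntropy_snd_mul_log_two (J : Z × β → ℝ) (A : Z → α) :
    condEntropy J (fun s => A s.1) (fun s => s.2) * Real.log 2 =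
      ∑ v, condTerm A (fun z => J (z, v)) := by
  classical
  have h2 : Real.log 2 ≠ 0 := (Real.log_pos one_lt_two).ne'
  have e1 : ∀ a v, prob J {s | (A s.1, s.2) = (a, v)} = prob (fun z => J (z, v)) {z | A z = a} := by
    intro a v
    simp only [prob_eq_sum_ite, Fintype.sum_prod_type, Set.mem_ofPred_eq, Prod.mk.injEq]
    refine Finset.sum_congr rfl fun z _ => ?_
    by_cases h : A z = a <;> simp [h]
  have e2 : ∀ v, prob J {s | s.2 = v} = ∑ z, J (z, v) := by
    intro v
    simp [prob_eq_sum_ite, Fintype.sum_prod_type]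
  simp only [condEntropy, entropy, sub_mul, Finset.sum_mul, div_mul_cancel₀ _ h2, condTerm,
    Finset.sum_sub_distrib, Fintype.sum_prod_type_right, e1, e2]

end Kernel

section Reduction

variable {X Y Ω β α : Type*} [Fintype X] [Fintype Y] [Fintype Ω] [Fintype β] [Fintype α]

lemma condEntropy_eq_of_law {q : Ω → ℝ} (A : X × Y → α) (Z : Ω → X × Y) (V : Ω → β) :
    condEntropy q (fun ω => A (Z ω)) V =
      condEntropy (fun s : (X × Y) × β => prob q {ω | (Z ω, V ω) = s})
        (fun s => A s.1) (fun s => s.2) := by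
  rw [condEntropy, condEntropy]
  congr 1
  · exact entropy_of_law (Z := fun ω => (Z ω, V ω)) (fun _ => rfl) (fun s => (A s.1, s.2))
  · exact entropy_of_law (Z := fun ω => (Z ω, V ω)) (fun _ => rfl) (fun s => s.2)

/-- The support lemma: an auxiliary variable can be replaced by one with few values that has the
same `H(Y | V)` and `H(X, Y | V)` and a no larger `H(X | V)`. -/
theorem exists_small_auxiliary {p : X × Y → ℝ} (hp : p ∈ stdSimplex ℝ (X × Y)) {q : Ω → ℝ}
    (hq : ∀ ω, 0 ≤ q ω) (Z : Ω → X × Y) (hZ : ∀ z, prob q {ω | Z ω = z} = p z) (V : Ω → β) :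
    ∃ m : ℕ, m ≤ Fintype.card X * Fintype.card Y + 2 ∧ ∃ w : X × Y → Fin m → ℝ,
      (∀ z, w z ∈ stdSimplex ℝ (Fin m)) ∧
      condEntropy (jointLaw p w) (fun ω => ω.1.1) (fun ω => ω.2) ≤
        condEntropy q (fun ω => (Z ω).1) V ∧
      condEntropy (jointLaw p w) (fun ω => ω.1.2) (fun ω => ω.2) =
        condEntropy q (fun ω => (Z ω).2) V ∧
      condEntropy (jointLaw p w) (fun ω => ω.1) (fun ω => ω.2) = condEntropy q Z V := by
  classical
  have h2 : 0 < Real.log 2 := Real.log_pos one_lt_two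
  set r : β → X × Y → ℝ := fun v z => prob q {ω | (Z ω, V ω) = (z, v)} with hr
  have hr0 : ∀ v z, 0 ≤ r v z := fun v z => prob_nonneg hq _
  have hrp : ∀ z, ∑ v, r v z = p z := by
    intro z
    rw [← hZ z]
    simp only [hr, prob_eq_sum_ite, Set.mem_ofPred_eq, Prod.mk.injEq]
    rw [Finset.sum_comm]
    refine Finset.sum_congr rfl fun ω _ => ?_
    by_cases h : Z ω = z <;> simp [h]
  set fX := condTerm (Prod.fst : X × Y → X) with hfX
  set fY := condTerm (Prod.snd : X × Y → Y) with hfY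
  set fZ := condTerm (id : X × Y → X × Y) with hfZ
  -- The index type has exactly `|X||Y| + 2` elements: two entropies and one mass for each pair.
  -- `H(X | V)` is left out as the objective, and total mass follows from the marginal.
  let a : β → Option (Option (X × Y)) → ℝ := fun v i => match i with
    | none => fY (r v)
    | some none => fZ (r v)
    | some (some z) => r v z
  let u : Option (Option (X × Y)) → ℝ := fun i => match i with
    | some (some _) => 1
    | _ => 0
  -- All weights equal to `1` would do, except that values of mass zero must leave the support for
  -- `u` to be positive there.
  set t : β → ℝ := fun v => if ∑ z, r v z = 0 then 0 else 1 with htdef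
  have htr : ∀ v, (fun z => t v * r v z) = r v := by
    intro v
    funext z
    by_cases h : ∑ z, r v z = 0
    · have := (Finset.sum_eq_zero_iff_of_nonneg fun z _ => hr0 v z).1 h z (Finset.mem_univ z)
      simp [this]
    · simp [htdef, h]
  obtain ⟨t', ht'0, heq, hle, hcard⟩ := exists_basic_solution a (fun v => fX (r v)) u t
    (fun v => by simp only [htdef]; split_ifs <;> norm_num) (by
      intro v hv
      have hne : ∑ z, r v z ≠ 0 := fun h => hv (by simp [htdef, h])
      simp only [Fintype.sum_option, u, a, zero_mul, zero_add, one_mul]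
      exact lt_of_le_of_ne (Finset.sum_nonneg fun z _ => hr0 v z) hne.symm)
  have hmarg : ∀ z, ∑ v, t' v * r v z = p z := fun z => by
    rw [← hrp z, heq (some (some z))]
    exact Finset.sum_congr rfl fun v _ => congrFun (htr v) z
  have hYeq : ∑ v, t' v * fY (r v) = ∑ v, fY (r v) := by
    rw [heq none]
    refine Finset.sum_congr rfl fun v _ => ?_
    simp only [a]
    conv_rhs => rw [← htr v, hfY, condTerm_const_mul]
  have hZeq : ∑ v, t' v * fZ (r v) = ∑ v, fZ (r v) := by
    rw [heq (some none)]
    refine Finset.sum_congr rfl fun v _ => ?_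
    simp only [a]
    conv_rhs => rw [← htr v, hfZ, condTerm_const_mul]
  have hXle : ∑ v, t' v * fX (r v) ≤ ∑ v, fX (r v) := by
    refine hle.trans (le_of_eq (Finset.sum_congr rfl fun v _ => ?_))
    conv_rhs => rw [← htr v, hfX, condTerm_const_mul]
  set m := Nat.card {v // t' v ≠ 0} with hm
  let e : Fin m ≃ {v // t' v ≠ 0} := (Finite.equivFin _).symm
  have hsum : ∀ f : β → ℝ, ∑ k, t' (e k) * f (e k) = ∑ v, t' v * f v := by
    intro f
    rw [e.sum_comp (fun v : {v // t' v ≠ 0} => t' v * f v)]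
    rw [← Finset.sum_filter_add_sum_filter_not Finset.univ (fun v => t' v ≠ 0),
      Finset.sum_eq_zero (s := Finset.univ.filter fun v => ¬ t' v ≠ 0), add_zero]
    · exact (Finset.sum_subtype (Finset.univ.filter fun v => t' v ≠ 0) (by simp)
        (fun v => t' v * f v)).symm
    · intro v hv
      simp only [Finset.mem_filter, not_not] at hv
      simp [hv.2]
  have hne : ∃ v, t' v ≠ 0 := by
    by_contra! hcon
    have := hp.2
    simp [← hmarg, hcon] at this
  obtain ⟨v₁, hv₁⟩ := hne
  -- Where `p z = 0` the kernel is unconstrained, and an arbitrary point mass keeps it stochastic.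
  set w : X × Y → Fin m → ℝ := fun z k =>
    if p z = 0 then (Pi.single (e.symm ⟨v₁, hv₁⟩) 1 : Fin m → ℝ) k
    else t' (e k) * r (e k) z / p z with hw
  have hJ : ∀ z k, jointLaw p w (z, k) = t' (e k) * r (e k) z := by
    intro z k
    by_cases h : p z = 0
    · have h0 := hrp z
      rw [h] at h0
      have := (Finset.sum_eq_zero_iff_of_nonneg fun v _ => hr0 v z).1 h0 (e k) (Finset.mem_univ _)
      simp [jointLaw, h, this]
    · simp [jointLaw, hw, h, mul_div_cancel₀]
  refine ⟨m, hcard.trans (by simp), w, fun z => ?_, ?_, ?_, ?_⟩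
  · by_cases h : p z = 0
    · have : w z = Pi.single (e.symm ⟨v₁, hv₁⟩) 1 := by
        funext k; simp [hw, h]
      rw [this]
      exact single_mem_stdSimplex ℝ _
    · refine ⟨fun k => ?_, ?_⟩
      · simp only [hw, h, if_false]
        exact div_nonneg (mul_nonneg (ht'0 _) (hr0 _ _)) (hp.1 z)
      · simp only [hw, h, if_false, ← Finset.sum_div]
        rw [hsum (fun v => r v z), hmarg, div_self h]
  · refine le_of_mul_le_mul_right ?_ h2
    rw [condEntropy_eq_of_law (q := q) Prod.fst, condEntropy_snd_mul_log_two _ Prod.fst,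
      condEntropy_snd_mul_log_two _ Prod.fst]
    simp only [hJ, condTerm_const_mul]
    rw [hsum fun v => fX (r v)]
    exact hXle
  · refine mul_right_cancel₀ h2.ne' ?_
    rw [condEntropy_eq_of_law (q := q) Prod.snd, condEntropy_snd_mul_log_two _ Prod.snd,
      condEntropy_snd_mul_log_two _ Prod.snd]
    simp only [hJ, condTerm_const_mul]
    rw [hsum fun v => fY (r v)]
    exact hYeq
  · refine mul_right_cancel₀ h2.ne' ?_
    rw [show Z = fun ω => id (Z ω) from rfl, condEntropy_eq_of_law (q := q) id]
    rw [condEntropy_snd_mul_log_two _ id]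
    rw [show (fun ω : (X × Y) × Fin m => ω.1) = fun ω => id ω.1 from rfl,
      condEntropy_snd_mul_log_two _ id]
    simp only [hJ, condTerm_const_mul]
    rw [hsum fun v => fZ (r v)]
    exact hZeq

end Reduction

/-! ### Single-letter rates in terms of three conditional entropies -/

/-- The rates supported by some auxiliary variable with at most `|X| |Y| + 2` values. -/
def AuxRates {X Y : Type*} [Fintype X] [Fintype Y] (p : X × Y → ℝ) (r : ℝ × ℝ) : Prop :=
  ∃ m : ℕ, m ≤ Fintype.card X * Fintype.card Y + 2 ∧
    ∃ w : X × Y → Fin m → ℝ, (∀ z, w z ∈ stdSimplex ℝ (Fin m)) ∧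
      max (condMutualInfo (jointLaw p w) (fun ω => ω.1.1) (fun ω => ω.2) (fun ω => ω.1.2))
          (condMutualInfo (jointLaw p w) (fun ω => ω.1.2) (fun ω => ω.2) (fun ω => ω.1.1)) ≤ r.1 ∧
      r.2 ≤ min (mutualInfo (jointLaw p w) (fun ω => ω.1.1) (fun ω => ω.2))
          (mutualInfo (jointLaw p w) (fun ω => ω.1.2) (fun ω => ω.2))

section Joint

variable {X Y V : Type*} [Fintype X] [Fintype Y] [Fintype V] {p : X × Y → ℝ} {w : X × Y → V → ℝ}

lemma jointLaw_mem_stdSimplex (hp : p ∈ stdSimplex ℝ (X × Y))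
    (hw : ∀ z, w z ∈ stdSimplex ℝ V) : jointLaw p w ∈ stdSimplex ℝ ((X × Y) × V) := by
  refine ⟨fun s => mul_nonneg (hp.1 _) ((hw _).1 _), ?_⟩
  rw [Fintype.sum_prod_type]
  simp only [jointLaw, ← Finset.mul_sum, (hw _).2, mul_one, hp.2]

lemma jointLaw_fst_law (hw : ∀ z, w z ∈ stdSimplex ℝ V) (z : X × Y) :
    prob (jointLaw p w) {s | s.1 = z} = p z := by
  classical
  rw [prob_eq_sum_ite, Fintype.sum_prod_type]
  simp only [Set.mem_ofPred_eq]
  rw [Fintype.sum_eq_single z fun z' h => Finset.sum_eq_zero fun v _ => if_neg h]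
  simp only [if_true, jointLaw, ← Finset.mul_sum, (hw z).2, mul_one]

lemma mutualInfo_jointLaw {α : Type*} [Fintype α] (hw : ∀ z, w z ∈ stdSimplex ℝ V)
    (A : X × Y → α) :
    mutualInfo (jointLaw p w) (fun ω => A ω.1) (fun ω => ω.2) =
      entropy p A - condEntropy (jointLaw p w) (fun ω => A ω.1) (fun ω => ω.2) := by
  rw [mutualInfo, entropy_of_law (jointLaw_fst_law hw)]

/-- In this form the dependence on the kernel is only through `H(X, Y | V)` and `H(Y | V)`, the
quantities that the support lemma controls. -/
lemma condMutualInfo_jointLaw_fst (hp : p ∈ stdSimplex ℝ (X × Y))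
    (hw : ∀ z, w z ∈ stdSimplex ℝ V) :
    condMutualInfo (jointLaw p w) (fun ω => ω.1.1) (fun ω => ω.2) (fun ω => ω.1.2) =
      entropy p (fun z => z) - entropy p Prod.snd -
        (condEntropy (jointLaw p w) (fun ω => ω.1) (fun ω => ω.2) -
          condEntropy (jointLaw p w) (fun ω => ω.1.2) (fun ω => ω.2)) := by
  have hJ := jointLaw_mem_stdSimplex hp hw
  have e1 := entropy_of_law (jointLaw_fst_law (p := p) hw) (fun z => z)
  have e2 := entropy_of_law (jointLaw_fst_law (p := p) hw) Prod.snd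
  have e3 : entropy (jointLaw p w) (fun ω => (ω.1.1, (ω.2, ω.1.2))) =
      entropy (jointLaw p w) (fun ω => (ω.1, ω.2)) :=
    entropy_congr hJ.1 fun _ _ => by simp only [Prod.ext_iff]; tauto
  have e4 := entropy_prod_comm hJ.1 (fun ω => ω.1.2) (fun ω => ω.2)
  rw [← e1, ← e2]
  simp only [condMutualInfo, condEntropy, e3, e4]
  ring

lemma condMutualInfo_jointLaw_snd (hp : p ∈ stdSimplex ℝ (X × Y))
    (hw : ∀ z, w z ∈ stdSimplex ℝ V) :
    condMutualInfo (jointLaw p w) (fun ω => ω.1.2) (fun ω => ω.2) (fun ω => ω.1.1) =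
      entropy p (fun z => z) - entropy p Prod.fst -
        (condEntropy (jointLaw p w) (fun ω => ω.1) (fun ω => ω.2) -
          condEntropy (jointLaw p w) (fun ω => ω.1.1) (fun ω => ω.2)) := by
  have hJ := jointLaw_mem_stdSimplex hp hw
  have e1 := entropy_of_law (jointLaw_fst_law (p := p) hw) (fun z => z)
  have e2 := entropy_of_law (jointLaw_fst_law (p := p) hw) Prod.fst
  have e3 : entropy (jointLaw p w) (fun ω => (ω.1.2, (ω.2, ω.1.1))) =
      entropy (jointLaw p w) (fun ω => (ω.1, ω.2)) :=
    entropy_congr hJ.1 fun _ _ => by simp only [Prod.ext_iff]; tauto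
  have e4 := entropy_prod_comm hJ.1 (fun ω => ω.1.1) (fun ω => ω.2)
  have e5 := entropy_prod_comm hJ.1 (fun ω => ω.1.2) (fun ω => ω.1.1)
  rw [← e1, ← e2]
  simp only [condMutualInfo, condEntropy, e3, e4, e5]
  ring

/-- Rates bounded through an arbitrary auxiliary variable are bounded through a small one. -/
theorem auxRates_of_variable {Ω β : Type*} [Fintype Ω] [Fintype β]
    (hp : p ∈ stdSimplex ℝ (X × Y)) {q : Ω → ℝ} (hq : ∀ ω, 0 ≤ q ω) (Z : Ω → X × Y)
    (hZ : ∀ z, prob q {ω | Z ω = z} = p z) (V : Ω → β) {r : ℝ × ℝ}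
    (h1 : entropy p (fun z => z) - entropy p Prod.snd -
      (condEntropy q Z V - condEntropy q (fun ω => (Z ω).2) V) ≤ r.1)
    (h2 : entropy p (fun z => z) - entropy p Prod.fst -
      (condEntropy q Z V - condEntropy q (fun ω => (Z ω).1) V) ≤ r.1)
    (h3 : r.2 ≤ entropy p Prod.fst - condEntropy q (fun ω => (Z ω).1) V)
    (h4 : r.2 ≤ entropy p Prod.snd - condEntropy q (fun ω => (Z ω).2) V) : AuxRates p r := by
  obtain ⟨m, hm, w, hw, e1, e2, e3⟩ := exists_small_auxiliary hp hq Z hZ V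
  refine ⟨m, hm, w, hw, max_le ?_ ?_, le_min ?_ ?_⟩
  · rw [condMutualInfo_jointLaw_fst hp hw]; linarith
  · rw [condMutualInfo_jointLaw_snd hp hw]; linarith
  · rw [mutualInfo_jointLaw hw Prod.fst]; linarith
  · rw [mutualInfo_jointLaw hw Prod.snd]; linarith

end Joint

/-! ### Closedness of the single-letter region -/

section Closed

variable {X Y : Type*} [Fintype X] [Fintype Y]

lemma continuous_entropy {Ω α : Type*} [Fintype Ω] [Fintype α] (A : Ω → α) :
    Continuous fun q : Ω → ℝ => entropy q A := by
  classical
  simp only [entropy, prob_eq_sum_ite]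
  refine continuous_finsetSum _ fun a _ => (Real.continuous_negMulLog.comp ?_).div_const _
  refine continuous_finsetSum _ fun ω _ => ?_
  split_ifs
  · exact continuous_apply ω
  · exact continuous_const

lemma continuous_entropy_jointLaw {V α : Type*} [Fintype V] [Fintype α] (p : X × Y → ℝ)
    (A : (X × Y) × V → α) :
    Continuous fun w : X × Y → V → ℝ => entropy (jointLaw p w) A := by
  refine (continuous_entropy A).comp (continuous_pi fun s => continuous_const.mul ?_)
  exact (continuous_apply s.2).comp (continuous_apply s.1)

/-- For each of the finitely many `m`, the rates are the projection of a closed set along the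
compact set of kernels; entropies are continuous in the kernel. -/
theorem isClosed_auxRates (p : X × Y → ℝ) : IsClosed {r | AuxRates p r} := by
  have : {r | AuxRates p r} = ⋃ m ∈ Set.Iic (Fintype.card X * Fintype.card Y + 2), {r |
    ∃ w : X × Y → Fin m → ℝ, (∀ z, w z ∈ stdSimplex ℝ (Fin m)) ∧
      max (condMutualInfo (jointLaw p w) (fun ω => ω.1.1) (fun ω => ω.2) (fun ω => ω.1.2))
          (condMutualInfo (jointLaw p w) (fun ω => ω.1.2) (fun ω => ω.2) (fun ω => ω.1.1)) ≤ r.1 ∧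
      r.2 ≤ min (mutualInfo (jointLaw p w) (fun ω => ω.1.1) (fun ω => ω.2))
          (mutualInfo (jointLaw p w) (fun ω => ω.1.2) (fun ω => ω.2))} := by
    ext r
    simp [AuxRates]
  rw [this]
  refine (Set.finite_Iic _).isClosed_biUnion fun m _ => ?_
  set K : Set (X × Y → Fin m → ℝ) := Set.univ.pi fun _ => stdSimplex ℝ (Fin m) with hK
  have hKc : IsCompact K := isCompact_univ_pi fun _ => isCompact_stdSimplex ℝ (Fin m)
  have : CompactSpace K := isCompact_iff_compactSpace.1 hKc
  have hval : Continuous fun s : K × (ℝ × ℝ) => (s.1 : X × Y → Fin m → ℝ) :=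
    continuous_subtype_val.comp continuous_fst
  have hT : IsClosed {s : K × (ℝ × ℝ) |
      max (condMutualInfo (jointLaw p s.1.1) (fun ω => ω.1.1) (fun ω => ω.2) (fun ω => ω.1.2))
          (condMutualInfo (jointLaw p s.1.1) (fun ω => ω.1.2) (fun ω => ω.2) (fun ω => ω.1.1))
        ≤ s.2.1 ∧
      s.2.2 ≤ min (mutualInfo (jointLaw p s.1.1) (fun ω => ω.1.1) (fun ω => ω.2))
          (mutualInfo (jointLaw p s.1.1) (fun ω => ω.1.2) (fun ω => ω.2))} := by
    simp only [condMutualInfo, mutualInfo, condEntropy]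
    refine IsClosed.inter (isClosed_le (Continuous.max ?_ ?_) (continuous_fst.comp continuous_snd))
      (isClosed_le (continuous_snd.comp continuous_snd) (Continuous.min ?_ ?_))
    · exact (((continuous_entropy_jointLaw p _).comp hval).sub
        ((continuous_entropy_jointLaw p _).comp hval)).sub
        (((continuous_entropy_jointLaw p _).comp hval).sub
        ((continuous_entropy_jointLaw p _).comp hval))
    · exact (((continuous_entropy_jointLaw p _).comp hval).sub
        ((continuous_entropy_jointLaw p _).comp hval)).sub
        (((continuous_entropy_jointLaw p _).comp hval).sub
        ((continuous_entropy_jointLaw p _).comp hval))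
    · exact ((continuous_entropy_jointLaw p _).comp hval).sub
        (((continuous_entropy_jointLaw p _).comp hval).sub
        ((continuous_entropy_jointLaw p _).comp hval))
    · exact ((continuous_entropy_jointLaw p _).comp hval).sub
        (((continuous_entropy_jointLaw p _).comp hval).sub
        ((continuous_entropy_jointLaw p _).comp hval))
  convert isClosedMap_snd_of_compactSpace _ hT using 1
  ext r
  constructor
  · rintro ⟨w, hw, h⟩
    exact ⟨(⟨w, fun z _ => hw z⟩, r), h, rfl⟩
  · rintro ⟨⟨⟨w, hw⟩, r'⟩, h, rfl⟩
    exact ⟨w, fun z => hw z (Set.mem_univ z), h⟩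

end Closed

/-! ### The converse -/

section Converse

variable {X Y : Type*} [Fintype X] [Fintype Y] {p : X × Y → ℝ} {n : ℕ}

/-- Single-letterisation: bounds on the information between the source sequences and a variable `U`
give single-letter rates. -/
theorem auxRates_of_sequence {υ : Type*} [Fintype υ] (hp : p ∈ stdSimplex ℝ (X × Y)) (hn : 0 < n)
    (U : (Fin n → X) × (Fin n → Y) → υ) {a b : ℝ}
    (h1 : condEntropy (iidLaw p n) U (fun ω => ω.2) ≤ n * a)
    (h2 : condEntropy (iidLaw p n) U (fun ω => ω.1) ≤ n * a)
    (h3 : n * b ≤ mutualInfo (iidLaw p n) U (fun ω => ω.1))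
    (h4 : n * b ≤ mutualInfo (iidLaw p n) U (fun ω => ω.2)) : AuxRates p (a, b) := by
  have hn' : (0 : ℝ) < n := by exact_mod_cast hn
  set q := iidLaw p n with hqdef
  have hq : q ∈ stdSimplex ℝ ((Fin n → X) × (Fin n → Y)) := iidLaw_mem_stdSimplex hp n
  -- With the time index adjoined this is `V = (Q, U, X^{Q-1}, Y^{Q-1})`. Both pasts are needed, for
  -- the chain rules in `X` and in `Y`.
  set W : Fin n × ((Fin n → X) × (Fin n → Y)) → υ × (Fin n → Option (X × Y)) :=
    fun s => (U s.2, mask s.1 fun j => (s.2.1 j, s.2.2 j)) with hW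
  set Z : Fin n × ((Fin n → X) × (Fin n → Y)) → X × Y := fun s => (s.2.1 s.1, s.2.2 s.1) with hZ
  have hlaw : ∀ z, prob (uniformProd q n) {s | Z s = z} = p z := by
    intro z
    classical
    rw [prob_eq_sum_ite, Fintype.sum_prod_type]
    have : ∀ i : Fin n, ∑ ω, (if (i, ω) ∈ {s | Z s = z} then uniformProd q n (i, ω) else 0) =
        p z / n := by
      intro i
      rw [← iidLaw_coord_law hp i z, prob_eq_sum_ite, Finset.sum_div]
      refine Finset.sum_congr rfl fun ω _ => ?_
      simp only [Set.mem_ofPred_eq, hZ, uniformProd, hqdef]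
      split_ifs <;> simp
    simp only [this]
    simp only [Finset.sum_const, Finset.card_univ, Fintype.card_fin, nsmul_eq_mul]
    field_simp
  have hcX := entropy_chain hq.1 U (fun ω => ω.1)
  have hcY := entropy_chain hq.1 U (fun ω => ω.2)
  have hcYX := entropy_chain hq.1 (fun ω => (U ω, ω.1)) (fun ω => ω.2)
  have hcXY := entropy_chain hq.1 (fun ω => (U ω, ω.2)) (fun ω => ω.1)
  have eXY : entropy q (fun ω => ((U ω, ω.2), ω.1)) = entropy q (fun ω => ((U ω, ω.1), ω.2)) :=
    entropy_congr hq.1 fun _ _ => by simp only [Prod.ext_iff]; tauto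
  -- `U` is a function of the two sources, so it adds no entropy to them.
  have efull : entropy q (fun ω => ((U ω, ω.1), ω.2)) = n * entropy p (fun z => z) := by
    rw [← entropy_iidLaw hp n]
    exact entropy_congr hq.1 fun ω ω' => by
      constructor
      · intro h
        simp only [Prod.mk.injEq] at h
        exact Prod.ext h.1.2 h.2
      · rintro rfl
        rfl
  have eX : entropy q (fun ω => ω.1) ≤ n * entropy p Prod.fst := by
    have h := entropy_chain hq.1 (fun _ => ()) (fun ω => ω.1)
    rw [entropy_of_const hq (A := fun _ => ()) (fun _ _ => rfl), sub_zero, entropy_congr hq.1 (B := fun ω => ω.1)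
      (fun _ _ => by simp)] at h
    rw [h]
    calc _ ≤ ∑ i : Fin n, entropy q (fun ω => ω.1 i) :=
          Finset.sum_le_sum fun i _ => condEntropy_le_entropy hq _ _
      _ = ∑ i : Fin n, entropy p Prod.fst :=
          Finset.sum_congr rfl fun i _ => entropy_iidLaw_coord hp Prod.fst i
      _ = _ := by simp
  have eY : entropy q (fun ω => ω.2) ≤ n * entropy p Prod.snd := by
    have h := entropy_chain hq.1 (fun _ => ()) (fun ω => ω.2)
    rw [entropy_of_const hq (A := fun _ => ()) (fun _ _ => rfl), sub_zero, entropy_congr hq.1 (B := fun ω => ω.2)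
      (fun _ _ => by simp)] at h
    rw [h]
    calc _ ≤ ∑ i : Fin n, entropy q (fun ω => ω.2 i) :=
          Finset.sum_le_sum fun i _ => condEntropy_le_entropy hq _ _
      _ = ∑ i : Fin n, entropy p Prod.snd :=
          Finset.sum_congr rfl fun i _ => entropy_iidLaw_coord hp Prod.snd i
      _ = _ := by simp
  set hZV := condEntropy (uniformProd q n) Z (fun s => (s.1, W s)) with hZV_def
  set hXV := condEntropy (uniformProd q n) (fun s => (Z s).1) (fun s => (s.1, W s)) with hXV_def
  set hYV := condEntropy (uniformProd q n) (fun s => (Z s).2) (fun s => (s.1, W s)) with hYV_def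
  have sZ : n * hZV = ∑ i, condEntropy q (fun ω => Z (i, ω)) (fun ω => W (i, ω)) := by
    rw [hZV_def, condEntropy_uniformProd hq hn]; field_simp
  have sX : n * hXV = ∑ i, condEntropy q (fun ω => (Z (i, ω)).1) (fun ω => W (i, ω)) := by
    rw [hXV_def, condEntropy_uniformProd hq hn (fun s => (Z s).1)]; field_simp
  have sY : n * hYV = ∑ i, condEntropy q (fun ω => (Z (i, ω)).2) (fun ω => W (i, ω)) := by
    rw [hYV_def, condEntropy_uniformProd hq hn (fun s => (Z s).2)]; field_simp
  have bX : n * hXV ≤ entropy q (fun ω => (U ω, ω.1)) - entropy q U := by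
    rw [sX, hcX]
    refine Finset.sum_le_sum fun i _ => condEntropy_anti hq _ fun ω ω' h => ?_
    simp only [hW, Prod.mk.injEq, mask_eq_iff] at h ⊢
    exact ⟨h.1, fun j hj => (h.2 j hj).1⟩
  have bY : n * hYV ≤ entropy q (fun ω => (U ω, ω.2)) - entropy q U := by
    rw [sY, hcY]
    refine Finset.sum_le_sum fun i _ => condEntropy_anti hq _ fun ω ω' h => ?_
    simp only [hW, Prod.mk.injEq, mask_eq_iff] at h ⊢
    exact ⟨h.1, fun j hj => (h.2 j hj).2⟩
  -- Opposite direction to `bX`: conditioning on all of `Xⁿ` determines `X_i` and `X^{i-1}`, so each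
  -- chain-rule term is at most `H(Y_i | X_i, V)`.
  have bYX : entropy q (fun ω => ((U ω, ω.1), ω.2)) - entropy q (fun ω => (U ω, ω.1)) ≤
      n * hZV - n * hXV := by
    rw [hcYX, sZ, sX, ← Finset.sum_sub_distrib]
    refine Finset.sum_le_sum fun i _ => ?_
    have e : condEntropy q (fun ω => Z (i, ω)) (fun ω => W (i, ω)) -
        condEntropy q (fun ω => (Z (i, ω)).1) (fun ω => W (i, ω)) =
        condEntropy q (fun ω => ω.2 i) (fun ω => (ω.1 i, W (i, ω))) := by
      have : entropy q (fun ω => (Z (i, ω), W (i, ω))) =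
          entropy q (fun ω => (ω.2 i, (ω.1 i, W (i, ω)))) :=
        entropy_congr hq.1 fun _ _ => by simp only [hZ, Prod.mk.injEq]; tauto
      simp only [hZ] at this ⊢
      simp only [condEntropy, this]
      ring
    rw [e]
    refine condEntropy_anti hq _ fun ω ω' h => ?_
    simp only [hW, Prod.mk.injEq, mask_eq_iff] at h ⊢
    exact ⟨congrFun h.1.2 i, h.1.1, fun j hj => ⟨congrFun h.1.2 j, h.2 j hj⟩⟩
  have bXY : entropy q (fun ω => ((U ω, ω.2), ω.1)) - entropy q (fun ω => (U ω, ω.2)) ≤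
      n * hZV - n * hYV := by
    rw [hcXY, sZ, sY, ← Finset.sum_sub_distrib]
    refine Finset.sum_le_sum fun i _ => ?_
    have e : condEntropy q (fun ω => Z (i, ω)) (fun ω => W (i, ω)) -
        condEntropy q (fun ω => (Z (i, ω)).2) (fun ω => W (i, ω)) =
        condEntropy q (fun ω => ω.1 i) (fun ω => (ω.2 i, W (i, ω))) := by
      have : entropy q (fun ω => (Z (i, ω), W (i, ω))) =
          entropy q (fun ω => (ω.1 i, (ω.2 i, W (i, ω)))) :=
        entropy_congr hq.1 fun _ _ => by simp only [hZ, Prod.mk.injEq]; tauto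
      simp only [hZ] at this ⊢
      simp only [condEntropy, this]
      ring
    rw [e]
    refine condEntropy_anti hq _ fun ω ω' h => ?_
    simp only [hW, Prod.mk.injEq, mask_eq_iff] at h ⊢
    exact ⟨congrFun h.1.2 i, h.1.1, fun j hj => ⟨h.2 j hj, congrFun h.1.2 j⟩⟩
  simp only [mutualInfo, condEntropy] at h1 h2 h3 h4
  refine auxRates_of_variable hp (uniformProd_mem_stdSimplex hq hn).1 Z hlaw
    (fun s => (s.1, W s)) ?_ ?_ ?_ ?_ <;> refine le_of_mul_le_mul_left ?_ hn' <;>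
    simp only [mul_sub, ← hZV_def, ← hXV_def, ← hYV_def] <;> linarith

/-- Every code has rates that are nearly supported by an auxiliary variable. -/
theorem auxRates_of_code (hp : p ∈ stdSimplex ℝ (X × Y)) (hn : 0 < n) (c : Code X Y n)
    {Rc Rk δ ε : ℝ} (hRc : 0 ≤ Rc) (hδ : 0 < δ) (hδ1 : δ ≤ 1)
    (hδε : δ * (Real.logb 2 (Fintype.card X) + Rc + 3) ≤ ε / 2) (hnε : 1 ≤ n * (ε / 2))
    (h1 : prob (iidLaw p n) {ω | c.key₁ ω ≠ c.key₂ ω} ≤ δ)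
    (h2 : 1 / (n : ℝ) * Real.logb 2 c.numMsg ≤ Rc + δ)
    (h3 : Rk - δ ≤ 1 / (n : ℝ) * entropy (iidLaw p n) c.key₁)
    (h4 : 1 / (n : ℝ) * mutualInfo (iidLaw p n) (fun ω => (c.key₁ ω, c.key₂ ω)) c.relay ≤ δ) :
    AuxRates p (Rc + ε, Rk - ε) := by
  classical
  have hn' : (0 : ℝ) < n := by exact_mod_cast hn
  have hq := iidLaw_mem_stdSimplex hp n
  set q := iidLaw p n with hqdef
  set L := Real.logb 2 (Fintype.card X) with hL
  rw [one_div_mul_eq_div, div_le_iff₀ hn'] at h2 h4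
  rw [one_div_mul_eq_div, le_div_iff₀ hn'] at h3
  obtain ⟨ω₀⟩ : Nonempty ((Fin n → X) × (Fin n → Y)) := by
    by_contra h
    have := hq.2
    rw [not_nonempty_iff] at h
    simp at this
  have hX : 0 < Fintype.card X := Fintype.card_pos_iff.2 ⟨ω₀.1 ⟨0, hn⟩⟩
  have hM : 0 < c.numMsg := (c.relay ω₀).pos
  have hX' : (1 : ℝ) ≤ Fintype.card X := by exact_mod_cast hX
  have hM' : (0 : ℝ) < c.numMsg := by exact_mod_cast hM
  have hL0 : 0 ≤ L := Real.logb_nonneg one_lt_two hX'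
  -- The size of the key alphabet is not controlled, but `K₁` takes at most `numMsg * |X|^n` values,
  -- whose logarithm is linear in `n`.
  have fano := condEntropy_le_fano hq c.key₁ c.key₂ (Finset.univ.image c.dec₁)
    (fun ω => Finset.mem_image_of_mem _ (Finset.mem_univ _))
    (N := c.numMsg * (Fintype.card X : ℝ) ^ n) (by positivity) (by
      have := Finset.card_image_le (s := Finset.univ) (f := c.dec₁)
      simp only [Finset.card_univ, Fintype.card_prod, Fintype.card_fin, Fintype.card_pi_const]
        at this
      exact_mod_cast this)
  rw [Real.logb_mul hM'.ne' (by positivity), Real.logb_pow, ← hL] at fano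
  have hfano : condEntropy q c.key₁ c.key₂ ≤ 1 + n * (δ * (L + Rc + 1)) := by
    have h5 : 0 ≤ n * (L + Rc + 1) := by positivity
    have h6 := mul_le_mul_of_nonneg_left (show Real.logb 2 c.numMsg + n * L ≤ n * (L + Rc + 1) by
      nlinarith) (prob_nonneg hq.1 {ω | c.key₁ ω ≠ c.key₂ ω})
    have h7 := mul_le_mul_of_nonneg_right h1 h5
    linarith
  set U : (Fin n → X) × (Fin n → Y) → Fin c.numMsg × Fin c.numKey :=
    fun ω => (c.relay ω, c.key₁ ω) with hU
  have hW : entropy q c.relay ≤ n * (Rc + δ) := by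
    have := entropy_le_logb_card hq c.relay
    rw [Fintype.card_fin] at this
    linarith
  have hWX : condEntropy q U (fun ω => ω.1) ≤ entropy q c.relay := by
    refine le_trans (le_of_eq ?_) (condEntropy_le_entropy hq c.relay (fun ω => ω.1))
    rw [condEntropy, condEntropy]
    congr 1
    refine entropy_congr hq.1 fun ω ω' => ?_
    simp only [hU, Prod.mk.injEq, Code.key₁]
    constructor
    · rintro ⟨⟨h, _⟩, h'⟩
      exact ⟨h, h'⟩
    · rintro ⟨h, h'⟩
      exact ⟨⟨h, by rw [h, h']⟩, h'⟩
  have hWY : condEntropy q U (fun ω => ω.2) ≤ entropy q c.relay + (1 + n * (δ * (L + Rc + 1))) := by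
    have e1 := condEntropy_le_entropy hq c.relay (fun ω => ω.2)
    have e2 : condEntropy q c.key₁ (fun ω => (c.relay ω, ω.2)) ≤ condEntropy q c.key₁ c.key₂ :=
      condEntropy_anti hq _ fun ω ω' h => congrArg c.dec₂ h
    have e3 : entropy q (fun ω => (U ω, ω.2)) =
        entropy q (fun ω => (c.key₁ ω, (c.relay ω, ω.2))) :=
      entropy_congr hq.1 fun _ _ => by simp only [hU, Prod.mk.injEq]; tauto
    simp only [condEntropy] at e1 e2 hfano ⊢
    linarith
  -- `H(K₁ | W_c) ≥ H(K₁) - nδ`, since `I(K₁; W_c) ≤ I(K₁, K₂; W_c)`; `e1` is that inequality.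
  have hK : entropy q c.key₁ - n * δ ≤ entropy q U - entropy q c.relay := by
    have e1 := condEntropy_prod_le hq c.key₂ c.relay c.key₁
    have e2 := entropy_prod_comm hq.1 c.relay c.key₁
    have e3 := entropy_prod_comm hq.1 c.key₁ c.key₂
    have e4 : entropy q (fun ω => (c.key₂ ω, (c.relay ω, c.key₁ ω))) =
        entropy q (fun ω => ((c.key₁ ω, c.key₂ ω), c.relay ω)) :=
      entropy_congr hq.1 fun _ _ => by simp only [Prod.mk.injEq]; tauto
    simp only [mutualInfo, condEntropy] at h4 e1 ⊢
    linarith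
  have hexp : n * (δ * (L + Rc + 3)) ≤ n * (ε / 2) := mul_le_mul_of_nonneg_left hδε hn'.le
  have hδn : 0 ≤ n * (δ * (L + Rc)) := by positivity
  have hδn' : 0 < n * δ := by positivity
  refine auxRates_of_sequence hp hn U ?_ ?_ ?_ ?_
  · nlinarith
  · nlinarith
  · rw [mutualInfo]; nlinarith
  · rw [mutualInfo]; nlinarith

/-- For each `ε` a single code, with `δ` small and `n` large, supports `(Rc + ε, Rk - ε)`;
closedness allows `ε → 0`. `Rk - ε` may be negative, which `AuxRates` permits. -/
theorem auxRates_of_achievable (hp : p ∈ stdSimplex ℝ (X × Y)) {Rc Rk : ℝ}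
    (h : Achievable p Rc Rk) : AuxRates p (Rc, Rk) := by
  obtain ⟨hRc, hRk, h⟩ := h
  have hL : 0 ≤ Real.logb 2 (Fintype.card X) := by
    rcases Nat.eq_zero_or_pos (Fintype.card X) with h0 | h0
    · simp [h0]
    · exact Real.logb_nonneg one_lt_two (by exact_mod_cast h0)
  have key : ∀ ε : ℝ, 0 < ε → AuxRates p (Rc + ε, Rk - ε) := by
    intro ε hε
    set D := Real.logb 2 (Fintype.card X) + Rc + 3 with hD
    have hD0 : 0 < D := by positivity
    have hδ : 0 < min 1 (ε / (2 * D)) := by positivity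
    obtain ⟨c, hc⟩ := h _ hδ
    obtain ⟨N, hN⟩ := exists_nat_ge (2 / ε)
    obtain ⟨n, ⟨h1, h2, h3, h4⟩, hn1, hnN⟩ := (hc.and ((Filter.eventually_ge_atTop 1).and
      (Filter.eventually_ge_atTop N))).exists
    refine auxRates_of_code hp hn1 (c n) hRc hδ (min_le_left _ _) ?_ ?_ h1 h2 h3 h4
    · calc min 1 (ε / (2 * D)) * D ≤ ε / (2 * D) * D :=
            mul_le_mul_of_nonneg_right (min_le_right _ _) hD0.le
        _ = ε / 2 := by field_simp
    · have : 2 / ε ≤ n := hN.trans (by exact_mod_cast hnN)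
      rw [div_le_iff₀ hε] at this
      linarith
  have hlim : Filter.Tendsto (fun ε : ℝ => (Rc + ε, Rk - ε)) (nhdsWithin 0 (Set.Ioi 0))
      (nhds (Rc, Rk)) := by
    have : Continuous fun ε : ℝ => (Rc + ε, Rk - ε) := by fun_prop
    simpa using (this.tendsto 0).mono_left nhdsWithin_le_nhds
  exact (isClosed_auxRates p).mem_of_tendsto hlim
    (Filter.eventually_of_mem self_mem_nhdsWithin fun ε hε => key ε hε)

end Converse

/-! ### Random binning in one shot -/

section Codebook

variable {ι 𝒱 Ω : Type*} [Fintype ι] [Fintype 𝒱] [Fintype Ω]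

/-- The law of a family of independent draws from `Q`. -/
noncomputable def codebookLaw (ι : Type*) [Fintype ι] (Q : 𝒱 → ℝ) : (ι → 𝒱) → ℝ :=
  fun C => ∏ j, Q (C j)

lemma prob_codebookLaw_forall [DecidableEq ι] (Q : 𝒱 → ℝ) (S : ι → Set 𝒱) :
    prob (codebookLaw ι Q) {C | ∀ j, C j ∈ S j} = ∏ j, prob Q (S j) := by
  classical
  simp only [prob_eq_sum_ite]
  rw [Finset.prod_univ_sum, Fintype.piFinset_univ]
  refine Finset.sum_congr rfl fun C _ => ?_
  rw [Finset.prod_ite_zero]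
  simp [codebookLaw]

lemma codebookLaw_mem_stdSimplex [DecidableEq ι] {Q : 𝒱 → ℝ} (hQ : Q ∈ stdSimplex ℝ 𝒱) :
    codebookLaw ι Q ∈ stdSimplex ℝ (ι → 𝒱) := by
  classical
  refine ⟨fun C => Finset.prod_nonneg fun j _ => hQ.1 _, ?_⟩
  have := prob_codebookLaw_forall Q (fun _ : ι => Set.univ)
  simpa [prob_univ, hQ.2] using this

lemma prob_codebookLaw_pair [DecidableEq ι] {Q : 𝒱 → ℝ} (hQ : Q ∈ stdSimplex ℝ 𝒱) {j j' : ι} (hj : j ≠ j')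
    (S S' : Set 𝒱) :
    prob (codebookLaw ι Q) {C | C j ∈ S ∧ C j' ∈ S'} = prob Q S * prob Q S' := by
  classical
  have h := prob_codebookLaw_forall Q
    (fun i => if i = j then S else if i = j' then S' else Set.univ)
  rw [Fintype.prod_eq_mul j j' hj] at h
  · rw [if_pos rfl, if_neg hj.symm, if_pos rfl] at h
    rw [← h]
    congr 1
    ext C
    constructor
    · rintro ⟨h1, h2⟩ i
      split_ifs with h3 h4
      · exact h3 ▸ h1
      · exact h4 ▸ h2
      · trivial
    · intro h'
      refine ⟨by simpa using h' j, by simpa [hj.symm] using h' j'⟩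
  · rintro i ⟨h1, h2⟩
    rw [if_neg h1, if_neg h2, prob_univ, hQ.2]

lemma prob_exists_le {q : Ω → ℝ} (hq : ∀ ω, 0 ≤ q ω) (S : ι → Set Ω) :
    prob q {ω | ∃ i, ω ∈ S i} ≤ ∑ i, prob q (S i) := by
  classical
  simp only [prob_eq_sum_ite]
  rw [Finset.sum_comm]
  refine Finset.sum_le_sum fun ω _ => ?_
  have hnn : ∀ i, 0 ≤ if ω ∈ S i then q ω else 0 := fun i => by
    split_ifs
    exacts [hq ω, le_rfl]
  split_ifs with h
  · obtain ⟨i, hi⟩ := h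
    refine le_trans (le_of_eq (if_pos hi).symm) (Finset.single_le_sum
      (f := fun i => if ω ∈ S i then q ω else 0) (fun i _ => hnn i) (Finset.mem_univ i))
  · exact Finset.sum_nonneg fun i _ => hnn i

lemma exists_le_of_sum_mul_le {q : Ω → ℝ} (hq : q ∈ stdSimplex ℝ Ω) {f : Ω → ℝ} {b : ℝ}
    (h : ∑ ω, q ω * f ω ≤ b) : ∃ ω, f ω ≤ b := by
  by_contra! hcon
  have h1 : ∑ ω, q ω * (f ω - b) ≤ 0 := by
    simp only [mul_sub, Finset.sum_sub_distrib, ← Finset.sum_mul, hq.2]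
    linarith
  have hnn : ∀ ω, 0 ≤ q ω * (f ω - b) := fun ω =>
    mul_nonneg (hq.1 ω) (by linarith [hcon ω])
  have h0 := le_antisymm h1 (Finset.sum_nonneg fun ω _ => hnn ω)
  have hz := (Finset.sum_eq_zero_iff_of_nonneg fun ω _ => hnn ω).1 h0
  have : ∑ ω, q ω = 0 := Finset.sum_eq_zero fun ω hω => by
    rcases mul_eq_zero.1 (hz ω hω) with h | h
    · exact h
    · linarith [hcon ω]
  rw [hq.2] at this
  exact one_ne_zero this

/-- Covering estimate: `N` draws all miss a set of `Q`-mass `s` whose mass under the channel is `t ≤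
a s`. Bound by `exp(-t N / a)` and use convexity of `exp` on `[0, 1]` in `t`. -/
lemma one_sub_pow_le {s t a : ℝ} (N : ℕ) (ha : 0 < a) (ht0 : 0 ≤ t) (ht1 : t ≤ 1) (hs : s ≤ 1)
    (hts : t ≤ a * s) : (1 - s) ^ N ≤ 1 - t + Real.exp (-(N / a)) := by
  have h1 : (1 - s) ^ N ≤ Real.exp (-(N * s)) := by
    rw [← mul_neg, Real.exp_nat_mul]
    refine pow_le_pow_left₀ (by linarith) ?_ N
    have := Real.add_one_le_exp (-s)
    linarith
  have h2 : Real.exp (-(N * s)) ≤ Real.exp (t * -(N / a) + (1 - t) * 0) := by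
    refine Real.exp_le_exp.2 ?_
    have : N * (t / a) ≤ N * s := by
      refine mul_le_mul_of_nonneg_left ?_ (Nat.cast_nonneg N)
      rw [div_le_iff₀ ha]
      linarith
    calc -(N * s) ≤ -(N * (t / a)) := neg_le_neg this
      _ = _ := by ring
  have h3 := convexOn_exp.2 (Set.mem_univ (-(N / a))) (Set.mem_univ 0) ht0
    (sub_nonneg.2 ht1) (by ring)
  simp only [smul_eq_mul, Real.exp_zero, mul_one] at h3
  have h4 : t * Real.exp (-(N / a)) ≤ Real.exp (-(N / a)) :=
    mul_le_of_le_one_left (Real.exp_pos _).le ht1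
  linarith

/-- A random codebook covers most source outputs while few of them see a confusable codeword in the
same bin. -/
theorem exists_codebook {p : Ω → ℝ} (hp : p ∈ stdSimplex ℝ Ω) {Q : 𝒱 → ℝ}
    (hQ : Q ∈ stdSimplex ℝ 𝒱) (W : Ω → 𝒱 → ℝ) (hW0 : ∀ ω v, 0 ≤ W ω v)
    (hW1 : ∀ ω, ∑ v, W ω v ≤ 1) (T B B' : Ω → Set 𝒱) {a b g : ℝ} (ha : 0 < a)
    (hcov : ∀ ω, ∀ v ∈ T ω, W ω v ≤ a * Q v) (hT : ∀ ω, prob Q (T ω) ≤ b)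
    (hB : ∀ ω, prob Q (B ω) ≤ g) (hB' : ∀ ω, prob Q (B' ω) ≤ g) (M K : ℕ) :
    ∃ C : Fin M × Fin K → 𝒱, prob p {ω | (∀ j, C j ∉ T ω) ∨ ∃ m k k', k' ≠ k ∧ C (m, k) ∈ T ω ∧
      (C (m, k') ∈ B ω ∨ C (m, k') ∈ B' ω)} ≤
      1 - ∑ ω, p ω * prob (W ω) (T ω) + Real.exp (-((M * K : ℕ) / a)) +
        M * K * (K - 1) * (2 * b * g) := by
  classical
  set QC := codebookLaw (Fin M × Fin K) Q with hQC
  have hQC' : QC ∈ stdSimplex ℝ (Fin M × Fin K → 𝒱) := codebookLaw_mem_stdSimplex hQ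
  set bad : Ω → (Fin M × Fin K → 𝒱) → Prop := fun ω C => (∀ j, C j ∉ T ω) ∨
    ∃ m k k', k' ≠ k ∧ C (m, k) ∈ T ω ∧ (C (m, k') ∈ B ω ∨ C (m, k') ∈ B' ω) with hbad
  have hone : ∀ ω, prob QC {C | bad ω C} ≤
      1 - prob (W ω) (T ω) + Real.exp (-((M * K : ℕ) / a)) + M * K * (K - 1) * (2 * b * g) := by
    intro ω
    have hb0 : 0 ≤ b := (prob_nonneg hQ.1 _).trans (hT ω)
    have hg0 : 0 ≤ g := (prob_nonneg hQ.1 _).trans (hB ω)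
    have h1 : prob QC {C | ∀ j, C j ∉ T ω} ≤
        1 - prob (W ω) (T ω) + Real.exp (-((M * K : ℕ) / a)) := by
      have := prob_codebookLaw_forall Q (fun _ : Fin M × Fin K => (T ω)ᶜ)
      rw [Finset.prod_const, Finset.card_univ, Fintype.card_prod, Fintype.card_fin,
        Fintype.card_fin] at this
      rw [show {C : Fin M × Fin K → 𝒱 | ∀ j, C j ∉ T ω} = {C | ∀ j, C j ∈ (T ω)ᶜ} from rfl, hQC,
        this]
      have h2 := prob_add_prob_compl Q (T ω)
      rw [hQ.2] at h2
      rw [show prob Q (T ω)ᶜ = 1 - prob Q (T ω) by linarith]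
      refine one_sub_pow_le _ ha (prob_nonneg (hW0 ω) _) ?_ (prob_le_one hQ _) ?_
      · refine (prob_mono (hW0 ω) (Set.subset_univ _)).trans ?_
        rw [prob_univ]
        exact hW1 ω
      · rw [prob_eq_sum_ite, prob_eq_sum_ite, Finset.mul_sum]
        refine Finset.sum_le_sum fun v _ => ?_
        split_ifs with hv
        · exact hcov ω v hv
        · simp
    -- Union bound over bin, chosen position and rival position; distinct codewords are independent,
    -- so each triple costs at most `2 b g`.
    have h2 : prob QC {C | ∃ t : Fin M × Fin K × Fin K, C ∈ {C : Fin M × Fin K → 𝒱 |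
        t.2.2 ≠ t.2.1 ∧ C (t.1, t.2.1) ∈ T ω ∧ (C (t.1, t.2.2) ∈ B ω ∨ C (t.1, t.2.2) ∈ B' ω)}} ≤
        M * K * (K - 1) * (2 * b * g) := by
      refine (prob_exists_le hQC'.1 _).trans ?_
      calc _ ≤ ∑ t : Fin M × Fin K × Fin K, if t.2.2 = t.2.1 then 0 else 2 * b * g := by
            refine Finset.sum_le_sum fun t _ => ?_
            split_ifs with h
            · simp [prob, h]
            have hne : (t.1, t.2.1) ≠ (t.1, t.2.2) := fun h' => h (Prod.mk.inj h').2.symm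
            calc _ ≤ prob QC ({C | C (t.1, t.2.1) ∈ T ω ∧ C (t.1, t.2.2) ∈ B ω} ∪
                  {C | C (t.1, t.2.1) ∈ T ω ∧ C (t.1, t.2.2) ∈ B' ω}) := by
                  refine prob_mono hQC'.1 ?_
                  rintro C ⟨-, h1, h2 | h2⟩
                  exacts [Or.inl ⟨h1, h2⟩, Or.inr ⟨h1, h2⟩]
              _ ≤ _ := prob_union_le hQC'.1 _ _
              _ = prob Q (T ω) * prob Q (B ω) + prob Q (T ω) * prob Q (B' ω) := by
                  rw [hQC, prob_codebookLaw_pair hQ hne, prob_codebookLaw_pair hQ hne]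
              _ ≤ b * g + b * g := add_le_add
                  (mul_le_mul (hT ω) (hB ω) (prob_nonneg hQ.1 _) hb0)
                  (mul_le_mul (hT ω) (hB' ω) (prob_nonneg hQ.1 _) hb0)
              _ = _ := by ring
        _ = M * K * (K - 1) * (2 * b * g) := by
            have h3 : ∀ k : Fin K, ∑ k' : Fin K, (if k' = k then 0 else 2 * b * g) =
                (K - 1) * (2 * b * g) := by
              intro k
              have h4 : ∀ k' : Fin K, (if k' = k then 0 else 2 * b * g) =
                  2 * b * g - if k' = k then 2 * b * g else 0 := fun k' => by
                split_ifs <;> ring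
              simp only [h4, Finset.sum_sub_distrib]
              simp
              ring
            rw [Fintype.sum_prod_type]
            simp only [Fintype.sum_prod_type, h3]
            simp
            ring
    have h3 : {C | bad ω C} = {C | ∀ j, C j ∉ T ω} ∪ {C | ∃ t : Fin M × Fin K × Fin K,
        C ∈ {C : Fin M × Fin K → 𝒱 | t.2.2 ≠ t.2.1 ∧ C (t.1, t.2.1) ∈ T ω ∧
          (C (t.1, t.2.2) ∈ B ω ∨ C (t.1, t.2.2) ∈ B' ω)}} := by
      ext C
      simp only [hbad, Set.mem_ofPred_eq, Set.mem_union, Prod.exists]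
    rw [h3]
    exact (prob_union_le hQC'.1 _ _).trans (add_le_add h1 h2)
  refine exists_le_of_sum_mul_le hQC' ?_
  -- The bound holds for each source output over random codebooks; exchanging the averages yields
  -- one codebook good on average over the source.
  have hswap : ∑ C, QC C * prob p {ω | bad ω C} = ∑ ω, p ω * prob QC {C | bad ω C} := by
    simp only [prob_eq_sum_ite, Finset.mul_sum, Set.mem_ofPred_eq]
    rw [Finset.sum_comm]
    refine Finset.sum_congr rfl fun ω _ => Finset.sum_congr rfl fun C _ => ?_
    split_ifs <;> ring
  rw [hswap]
  refine (Finset.sum_le_sum fun ω _ => mul_le_mul_of_nonneg_left (hone ω) (hp.1 ω)).trans ?_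
  simp only [mul_add, mul_sub, Finset.sum_add_distrib, Finset.sum_sub_distrib, ← Finset.sum_mul,
    hp.2]
  simp

/-- One-shot achievability. -/
theorem exists_code {X Y : Type*} [Fintype X] [Fintype Y] {n : ℕ}
    {p : (Fin n → X) × (Fin n → Y) → ℝ} (hp : p ∈ stdSimplex ℝ ((Fin n → X) × (Fin n → Y)))
    {Q : 𝒱 → ℝ} (hQ : Q ∈ stdSimplex ℝ 𝒱) (W : (Fin n → X) × (Fin n → Y) → 𝒱 → ℝ)
    (hW0 : ∀ ω v, 0 ≤ W ω v) (hW1 : ∀ ω, ∑ v, W ω v ≤ 1)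
    (T : (Fin n → X) × (Fin n → Y) → Set 𝒱) (B : (Fin n → X) → Set 𝒱) (B' : (Fin n → Y) → Set 𝒱)
    {a b g : ℝ} (ha : 0 < a)
    (hcov : ∀ ω, ∀ v ∈ T ω, W ω v ≤ a * Q v) (hT : ∀ ω, prob Q (T ω) ≤ b)
    (hTv : ∀ v, prob p {ω | v ∈ T ω} ≤ b)
    (hB : ∀ x, prob Q (B x) ≤ g) (hB' : ∀ y, prob Q (B' y) ≤ g)
    (hTB : ∀ ω, T ω ⊆ B ω.1) (hTB' : ∀ ω, T ω ⊆ B' ω.2) (M K : ℕ) (hM : 0 < M) (hK : 0 < K) :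
    ∃ c : Code X Y n, c.numMsg = M ∧ c.numKey = K ∧ ∃ G : Set ((Fin n → X) × (Fin n → Y)),
      prob p Gᶜ ≤ 1 - ∑ ω, p ω * prob (W ω) (T ω) + Real.exp (-((M * K : ℕ) / a)) +
        M * K * (K - 1) * (2 * b * g) ∧
      (∀ ω ∈ G, c.key₁ ω = c.key₂ ω) ∧
      ∀ s, prob p ({ω | (c.relay ω, c.key₁ ω) = s} ∩ G) ≤ b := by
  classical
  obtain ⟨C, hC⟩ := exists_codebook hp hQ W hW0 hW1 T (fun ω => B ω.1) (fun ω => B' ω.2) ha hcov hT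
    (fun ω => hB ω.1) (fun ω => hB' ω.2) M K
  let enc : (Fin n → X) × (Fin n → Y) → Fin M := fun ω =>
    -- The default values here and in the decoders are never used on `G`.
    if h : ∃ j, C j ∈ T ω then h.choose.1 else ⟨0, hM⟩
  let d₁ : Fin M × (Fin n → X) → Fin K := fun s =>
    if h : ∃ k, C (s.1, k) ∈ B s.2 then h.choose else ⟨0, hK⟩
  let d₂ : Fin M × (Fin n → Y) → Fin K := fun s =>
    if h : ∃ k, C (s.1, k) ∈ B' s.2 then h.choose else ⟨0, hK⟩
  set G : Set ((Fin n → X) × (Fin n → Y)) := {ω | (∀ j, C j ∉ T ω) ∨ ∃ m k k', k' ≠ k ∧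
    C (m, k) ∈ T ω ∧ (C (m, k') ∈ B ω.1 ∨ C (m, k') ∈ B' ω.2)}ᶜ with hG
  have key : ∀ ω ∈ G, C (enc ω, d₁ (enc ω, ω.1)) ∈ T ω ∧ d₁ (enc ω, ω.1) = d₂ (enc ω, ω.2) := by
    intro ω hω
    simp only [hG, Set.mem_compl_iff, Set.mem_ofPred_eq, not_or, not_forall, not_not, not_exists,
      not_and] at hω
    obtain ⟨hex, huniq⟩ := hω
    obtain ⟨k, hk⟩ : ∃ k, C (enc ω, k) ∈ T ω := by
      refine ⟨hex.choose.2, ?_⟩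
      simp only [enc, dif_pos hex]
      exact hex.choose_spec
    have e1 : d₁ (enc ω, ω.1) = k := by
      have h : ∃ k, C (enc ω, k) ∈ B ω.1 := ⟨k, hTB ω hk⟩
      have hs : d₁ (enc ω, ω.1) = h.choose := dif_pos h
      rw [hs]
      by_contra hne
      exact (huniq _ _ _ hne hk).1 h.choose_spec
    have e2 : d₂ (enc ω, ω.2) = k := by
      have h : ∃ k, C (enc ω, k) ∈ B' ω.2 := ⟨k, hTB' ω hk⟩
      have hs : d₂ (enc ω, ω.2) = h.choose := dif_pos h
      rw [hs]
      by_contra hne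
      exact (huniq _ _ _ hne hk).2 h.choose_spec
    exact ⟨by rw [e1]; exact hk, by rw [e1, e2]⟩
  refine ⟨⟨M, K, enc, d₁, d₂⟩, rfl, rfl, G, by rw [hG, compl_compl]; exact hC,
    fun ω hω => (key ω hω).2, fun s => (prob_mono hp.1 ?_).trans (hTv (C s))⟩
  rintro ω ⟨h1, h2⟩
  have h3 := (key ω h2).1
  rw [← show (enc ω, d₁ (enc ω, ω.1)) = s from h1]
  exact h3

end Codebook

/-! ### Memoryless channels and information density -/

section Channel

variable {Z V α : Type*} [Fintype Z] [Fintype V] {J : Z × V → ℝ}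

/-- The marginal law of the second component. -/
noncomputable def sndLaw (J : Z × V → ℝ) (v : V) : ℝ := prob J {s | s.2 = v}

/-- The conditional law of `V` given `A`, under the law `J` of `(Z, V)`; it vanishes off the support
of `A`. -/
noncomputable def channel (J : Z × V → ℝ) (A : Z → α) (a : α) (v : V) : ℝ :=
  prob J {s | (A s.1, s.2) = (a, v)} / prob J {s | A s.1 = a}

/-- The information density, in nats, between `A` and `V`. -/
noncomputable def infoDensity (J : Z × V → ℝ) (A : Z → α) (s : Z × V) : ℝ :=
  Real.log (channel J A (A s.1) s.2 / sndLaw J s.2)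

lemma sndLaw_mem_stdSimplex (hJ : J ∈ stdSimplex ℝ (Z × V)) : sndLaw J ∈ stdSimplex ℝ V :=
  ⟨fun _ => prob_nonneg hJ.1 _, (sum_prob_fiber J Prod.snd).trans hJ.2⟩

lemma channel_nonneg (hJ : ∀ s, 0 ≤ J s) (A : Z → α) (a : α) (v : V) : 0 ≤ channel J A a v :=
  div_nonneg (prob_nonneg hJ _) (prob_nonneg hJ _)

lemma sum_prob_pair (J : Z × V → ℝ) (A : Z → α) (a : α) :
    ∑ v, prob J {s | (A s.1, s.2) = (a, v)} = prob J {s | A s.1 = a} := by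
  classical
  simp only [prob_eq_sum_ite, Set.mem_ofPred_eq, Prod.mk.injEq]
  rw [Finset.sum_comm]
  refine Finset.sum_congr rfl fun s _ => ?_
  by_cases h : A s.1 = a <;> simp [h]

lemma sum_channel_le_one (hJ : ∀ s, 0 ≤ J s) (A : Z → α) (a : α) : ∑ v, channel J A a v ≤ 1 := by
  simp only [channel, ← Finset.sum_div, sum_prob_pair]
  exact div_le_one_of_le₀ le_rfl (prob_nonneg hJ _)

lemma channel_pos (hJ : ∀ s, 0 ≤ J s) (A : Z → α) {s : Z × V} (hs : 0 < J s) :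
    0 < channel J A (A s.1) s.2 :=
  div_pos (hs.trans_le (le_prob_of_mem hJ (by simp))) (hs.trans_le (le_prob_of_mem hJ (by simp)))

lemma sndLaw_pos (hJ : ∀ s, 0 ≤ J s) {s : Z × V} (hs : 0 < J s) : 0 < sndLaw J s.2 :=
  hs.trans_le (le_prob_of_mem hJ (by simp))

lemma sum_mul_infoDensity [Fintype α] (hJ : ∀ s, 0 ≤ J s) (A : Z → α) :
    ∑ s, J s * infoDensity J A s =
      mutualInfo J (fun s => A s.1) (fun s => s.2) * Real.log 2 := by
  rw [mutualInfo, condEntropy, sub_mul, sub_mul, entropy_mul_log_two, entropy_mul_log_two,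
    entropy_mul_log_two]
  simp only [sub_eq_add_neg, neg_add, neg_neg, ← Finset.sum_neg_distrib,
    ← Finset.sum_add_distrib]
  refine Finset.sum_congr rfl fun s _ => ?_
  rcases (hJ s).eq_or_lt with h0 | h0
  · simp [← h0]
  have h1 : 0 < prob J {s' | (A s'.1, s'.2) = (A s.1, s.2)} :=
    h0.trans_le (le_prob_of_mem hJ (by simp))
  have h2 : 0 < prob J {s' | A s'.1 = A s.1} := h0.trans_le (le_prob_of_mem hJ (by simp))
  have h3 : 0 < sndLaw J s.2 := sndLaw_pos hJ h0
  rw [infoDensity, channel, Real.log_div (by positivity) h3.ne', Real.log_div h1.ne' h2.ne']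
  simp only [sndLaw]
  ring

variable {n : ℕ}

/-- The law of `n` independent copies of `V`. -/
noncomputable def sndLawSeq (J : Z × V → ℝ) (n : ℕ) (v : Fin n → V) : ℝ := ∏ i, sndLaw J (v i)

/-- The memoryless extension of `channel`. -/
noncomputable def channelSeq (J : Z × V → ℝ) (A : Z → α) (a : Fin n → α) (v : Fin n → V) : ℝ :=
  ∏ i, channel J A (a i) (v i)

lemma sndLawSeq_mem_stdSimplex (hJ : J ∈ stdSimplex ℝ (Z × V)) (n : ℕ) :
    sndLawSeq J n ∈ stdSimplex ℝ (Fin n → V) :=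
  codebookLaw_mem_stdSimplex (sndLaw_mem_stdSimplex hJ)

lemma channelSeq_nonneg (hJ : ∀ s, 0 ≤ J s) (A : Z → α) (a : Fin n → α) (v : Fin n → V) :
    0 ≤ channelSeq J A a v :=
  Finset.prod_nonneg fun _ _ => channel_nonneg hJ _ _ _

lemma sum_channelSeq_le_one (hJ : ∀ s, 0 ≤ J s) (A : Z → α) (a : Fin n → α) :
    ∑ v, channelSeq J A a v ≤ 1 := by
  classical
  have : ∑ v : Fin n → V, channelSeq J A a v = ∏ i, ∑ v, channel J A (a i) v := by
    rw [Finset.prod_univ_sum, Fintype.piFinset_univ]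
    rfl
  rw [this]
  exact Finset.prod_le_one (fun i _ => Finset.sum_nonneg fun v _ => channel_nonneg hJ _ _ _)
    fun i _ => sum_channel_le_one hJ A (a i)

/-- Sequences whose information density with `a` is large are unlikely under the product law. -/
lemma prob_channelSeq_ge_le (hJ : J ∈ stdSimplex ℝ (Z × V)) (A : Z → α) (a : Fin n → α) (t : ℝ)
    (S : Set (Fin n → V)) (hS : ∀ v ∈ S, Real.exp t * sndLawSeq J n v ≤ channelSeq J A a v) :
    prob (sndLawSeq J n) S ≤ Real.exp (-t) := by
  classical
  have h1 : Real.exp t * prob (sndLawSeq J n) S ≤ 1 := by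
    refine le_trans ?_ (sum_channelSeq_le_one hJ.1 A a)
    rw [prob_eq_sum_ite, Finset.mul_sum]
    refine Finset.sum_le_sum fun v _ => ?_
    split_ifs with hv
    · exact hS v hv
    · rw [mul_zero]; exact channelSeq_nonneg hJ.1 A a v
  rw [Real.exp_neg, ← one_div, le_div_iff₀ (Real.exp_pos t)]
  linarith

/-- On sequences of positive mass the likelihood ratio is exactly the exponential of the sum of the
information densities. -/
lemma channelSeq_bounds (hJ : ∀ s, 0 ≤ J s) (A : Z → α) {z : Fin n → Z} {v : Fin n → V}
    (hpos : ∀ i, 0 < J (z i, v i)) {I ε : ℝ}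
    (h : |∑ i, infoDensity J A (z i, v i) - n * I| ≤ n * ε) :
    Real.exp (n * (I - ε)) * sndLawSeq J n v ≤ channelSeq J A (fun i => A (z i)) v ∧
      channelSeq J A (fun i => A (z i)) v ≤ Real.exp (n * (I + ε)) * sndLawSeq J n v := by
  have hQ : 0 < sndLawSeq J n v := Finset.prod_pos fun i _ => sndLaw_pos hJ (hpos i)
  have e : channelSeq J A (fun i => A (z i)) v =
      Real.exp (∑ i, infoDensity J A (z i, v i)) * sndLawSeq J n v := by
    rw [Real.exp_sum, sndLawSeq, ← Finset.prod_mul_distrib]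
    refine Finset.prod_congr rfl fun i _ => ?_
    have h1 : 0 < channel J A (A (z i)) (v i) := channel_pos hJ A (hpos i)
    have h2 : 0 < sndLaw J (v i) := sndLaw_pos hJ (hpos i)
    rw [infoDensity, Real.exp_log (div_pos h1 h2), div_mul_cancel₀ _ h2.ne']
  obtain ⟨h1, h2⟩ := abs_le.1 h
  rw [e]
  constructor <;> refine mul_le_mul_of_nonneg_right (Real.exp_le_exp.2 ?_) hQ.le <;> linarith

end Channel

/-! ### Typical sets -/

section Typical

variable {X Y V : Type*} [Fintype X] [Fintype Y] [Fintype V] {p : X × Y → ℝ} {n : ℕ}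

/-- The sequences `v` whose information densities with the source output are close to their means
`i`, `i₁`, `i₂`. -/
def typicalSet (J : (X × Y) × V → ℝ) (n : ℕ) (i i₁ i₂ ε : ℝ) (ω : (Fin n → X) × (Fin n → Y)) :
    Set (Fin n → V) :=
  {v | 0 < sndLawSeq J n v ∧
    Real.exp (n * (i - ε)) * sndLawSeq J n v ≤ channelSeq J id (fun k => (ω.1 k, ω.2 k)) v ∧
    channelSeq J id (fun k => (ω.1 k, ω.2 k)) v ≤ Real.exp (n * (i + ε)) * sndLawSeq J n v ∧
    Real.exp (n * (i₁ - ε)) * sndLawSeq J n v ≤ channelSeq J Prod.fst ω.1 v ∧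
    Real.exp (n * (i₂ - ε)) * sndLawSeq J n v ≤ channelSeq J Prod.snd ω.2 v}

lemma mul_channel_id {J : (X × Y) × V → ℝ} (hJ : ∀ s, 0 ≤ J s)
    (hp : ∀ z, prob J {s | s.1 = z} = p z) (z : X × Y) (v : V) :
    p z * channel J id z v = J (z, v) := by
  have e : prob J {s | (id s.1, s.2) = (z, v)} = J (z, v) := by
    rw [← prob_setOf_eq J (z, v)]
    rfl
  rw [channel, e, ← hp z]
  have hle : J (z, v) ≤ prob J {s | s.1 = z} := le_prob_of_mem hJ (by simp)
  by_cases h : prob J {s | s.1 = z} = 0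
  · rw [h] at hle ⊢
    rw [zero_mul]
    exact le_antisymm (hJ _) hle
  · exact mul_div_cancel₀ _ h

lemma iidLaw_mul_channelSeq {J : (X × Y) × V → ℝ} (hJ : ∀ s, 0 ≤ J s)
    (hp : ∀ z, prob J {s | s.1 = z} = p z) (ω : (Fin n → X) × (Fin n → Y)) (v : Fin n → V) :
    iidLaw p n ω * channelSeq J id (fun k => (ω.1 k, ω.2 k)) v =
      iidLaw J n (fun k => (ω.1 k, ω.2 k), v) := by
  simp only [iidLaw, channelSeq, ← Finset.prod_mul_distrib, mul_channel_id hJ hp]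

/-- Averaging the channel over the source returns `P_V^n(v)`, while on this event the channel is at
least `exp(n(i - ε))` times that. Secrecy rests on this bound. The requirement `0 < sndLawSeq J n v`
in `typicalSet` excludes null `v`, for which the inequalities could read `0 ≤ 0`. -/
lemma prob_typicalSet_fiber_le {J : (X × Y) × V → ℝ} (hJ : J ∈ stdSimplex ℝ ((X × Y) × V))
    (hp : ∀ z, prob J {s | s.1 = z} = p z) (hp' : p ∈ stdSimplex ℝ (X × Y)) (i i₁ i₂ ε : ℝ)
    (v : Fin n → V) :
    prob (iidLaw p n) {ω | v ∈ typicalSet J n i i₁ i₂ ε ω} ≤ Real.exp (-(n * (i - ε))) := by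
  classical
  have hq := iidLaw_mem_stdSimplex hp' n
  rcases (sndLawSeq_mem_stdSimplex hJ n).1 v |>.eq_or_lt with h0 | h0
  · have : {ω | v ∈ typicalSet J n i i₁ i₂ ε ω} = ∅ := by
      ext ω
      simp [typicalSet, ← h0]
    rw [this]
    simp only [prob, Set.indicator_empty, Finset.sum_const_zero]
    exact (Real.exp_pos _).le
  have hsum : ∑ ω, iidLaw p n ω * channelSeq J id (fun k => (ω.1 k, ω.2 k)) v =
      sndLawSeq J n v := by
    simp only [iidLaw, channelSeq, ← Finset.prod_mul_distrib, mul_channel_id hJ.1 hp]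
    rw [sum_prod_coords fun k z => J (z, v k)]
    refine Finset.prod_congr rfl fun k _ => ?_
    conv_rhs => rw [sndLaw, prob_eq_sum_ite, Fintype.sum_prod_type]
    exact Finset.sum_congr rfl fun z _ => by simp
  have h1 : Real.exp (n * (i - ε)) * sndLawSeq J n v *
      prob (iidLaw p n) {ω | v ∈ typicalSet J n i i₁ i₂ ε ω} ≤ sndLawSeq J n v := by
    refine le_trans ?_ hsum.le
    rw [prob_eq_sum_ite, Finset.mul_sum]
    refine Finset.sum_le_sum fun ω _ => ?_
    split_ifs with hv
    · rw [mul_comm]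
      exact mul_le_mul_of_nonneg_left hv.2.1 (hq.1 ω)
    · rw [mul_zero]
      exact mul_nonneg (hq.1 ω) (channelSeq_nonneg hJ.1 _ _ _)
  rw [Real.exp_neg, ← one_div, le_div_iff₀ (Real.exp_pos _)]
  refine le_of_mul_le_mul_left ?_ h0
  linarith

/-- A bound on the sum of the variances of the information densities. -/
noncomputable def densityVariance (J : (X × Y) × V → ℝ) : ℝ :=
  (∑ s, J s * (infoDensity J id s - ∑ s, J s * infoDensity J id s) ^ 2) +
  (∑ s, J s * (infoDensity J Prod.fst s - ∑ s, J s * infoDensity J Prod.fst s) ^ 2) +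
  ∑ s, J s * (infoDensity J Prod.snd s - ∑ s, J s * infoDensity J Prod.snd s) ^ 2

/-- The sum is the probability that `n` i.i.d. copies under `J` are jointly typical; Chebyshev's
inequality for the three densities bounds the complement. -/
lemma one_sub_prob_typicalSet_le {J : (X × Y) × V → ℝ} (hJ : J ∈ stdSimplex ℝ ((X × Y) × V))
    (hp : ∀ z, prob J {s | s.1 = z} = p z) {ε : ℝ} (hε : 0 < ε) (hn : 0 < n) :
    1 - ∑ ω, iidLaw p n ω * prob (channelSeq J id fun k => (ω.1 k, ω.2 k))
      (typicalSet J n (∑ s, J s * infoDensity J id s) (∑ s, J s * infoDensity J Prod.fst s)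
        (∑ s, J s * infoDensity J Prod.snd s) ε ω) ≤ densityVariance J / (n * ε ^ 2) := by
  classical
  have hq := iidLaw_mem_stdSimplex hJ n
  set i := ∑ s, J s * infoDensity J id s with hi
  set i₁ := ∑ s, J s * infoDensity J Prod.fst s with hi₁
  set i₂ := ∑ s, J s * infoDensity J Prod.snd s with hi₂
  set S : Set ((Fin n → X × Y) × (Fin n → V)) :=
    {s | s.2 ∈ typicalSet J n i i₁ i₂ ε (fun k => (s.1 k).1, fun k => (s.1 k).2)} with hS
  have e : ∑ ω, iidLaw p n ω * prob (channelSeq J id fun k => (ω.1 k, ω.2 k))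
      (typicalSet J n i i₁ i₂ ε ω) = prob (iidLaw J n) S := by
    conv_rhs => rw [prob_eq_sum_ite, Fintype.sum_prod_type]
    refine Fintype.sum_equiv (Equiv.arrowProdEquivProdArrow (Fin n) (fun _ => X) (fun _ => Y)).symm
      _ _ fun ω => ?_
    rw [prob_eq_sum_ite, Finset.mul_sum]
    refine Finset.sum_congr rfl fun v _ => ?_
    rw [mul_ite, iidLaw_mul_channelSeq hJ.1 hp, mul_zero]
    rfl
  rw [e]
  have hc := prob_add_prob_compl (iidLaw J n) S
  rw [hq.2] at hc
  rw [show 1 - prob (iidLaw J n) S = prob (iidLaw J n) Sᶜ by linarith]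
  let D : ((X × Y) × V → ℝ) → Set ((Fin n → X × Y) × (Fin n → V)) := fun f =>
    {s | n * ε < |∑ k, f (s.1 k, s.2 k) - n * ∑ s, J s * f s|}
  have hsub : prob (iidLaw J n) Sᶜ ≤ prob (iidLaw J n)
      (D (infoDensity J id) ∪ D (infoDensity J Prod.fst) ∪ D (infoDensity J Prod.snd)) := by
    rw [prob_eq_sum_ite, prob_eq_sum_ite]
    refine Finset.sum_le_sum fun s _ => ?_
    rcases (hq.1 s).eq_or_lt with h0 | h0
    · simp [← h0]
    by_cases hD : s ∈ D (infoDensity J id) ∪ D (infoDensity J Prod.fst) ∪ D (infoDensity J Prod.snd)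
    · rw [if_pos hD]
      split_ifs
      exacts [le_rfl, h0.le]
    have hmem : s ∈ S := by
      simp only [Set.mem_union, not_or] at hD
      have hpos : ∀ k, 0 < J (s.1 k, s.2 k) := fun k =>
        lt_of_le_of_ne (hJ.1 _) fun h => h0.ne' (Finset.prod_eq_zero (Finset.mem_univ k) h.symm)
      have b := channelSeq_bounds hJ.1 id hpos (not_lt.1 hD.1.1)
      have b₁ := channelSeq_bounds hJ.1 Prod.fst hpos (not_lt.1 hD.1.2)
      have b₂ := channelSeq_bounds hJ.1 Prod.snd hpos (not_lt.1 hD.2)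
      exact ⟨Finset.prod_pos fun k _ => sndLaw_pos hJ.1 (hpos k), b.1, b.2, b₁.1, b₂.1⟩
    rw [if_neg hD, if_neg fun h : s ∈ Sᶜ => h hmem]
  have c := prob_iidLaw_deviation_le hJ (infoDensity J id) hε hn
  have c₁ := prob_iidLaw_deviation_le hJ (infoDensity J Prod.fst) hε hn
  have c₂ := prob_iidLaw_deviation_le hJ (infoDensity J Prod.snd) hε hn
  rw [densityVariance, add_div, add_div]
  refine hsub.trans ((prob_union_le hq.1 _ _).trans (add_le_add ((prob_union_le hq.1 _ _).trans
    (add_le_add c c₁)) c₂))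

end Typical

/-! ### Achievability -/

section Achievability

variable {X Y V : Type*} [Fintype X] [Fintype Y] [Fintype V] {p : X × Y → ℝ}

/-- The failure probability of the random code of length `n`. -/
noncomputable def failureBound (J : (X × Y) × V → ℝ) (ε : ℝ) (n : ℕ) : ℝ :=
  densityVariance J / (n * ε ^ 2) + Real.exp (-(Real.exp (n * ε) / 2)) + 4 * Real.exp (-(2 * n * ε))

lemma tendsto_failureBound (J : (X × Y) × V → ℝ) {ε : ℝ} (hε : 0 < ε) :
    Filter.Tendsto (failureBound J ε) Filter.atTop (nhds 0) := by
  have h0 : Filter.Tendsto (fun n : ℕ => (n : ℝ) * ε) Filter.atTop Filter.atTop :=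
    tendsto_natCast_atTop_atTop.atTop_mul_const hε
  have h1 : Filter.Tendsto (fun n : ℕ => densityVariance J / (n * ε ^ 2)) Filter.atTop (nhds 0) :=
    Filter.Tendsto.const_div_atTop
      (tendsto_natCast_atTop_atTop.atTop_mul_const (by positivity)) _
  have h2 : Filter.Tendsto (fun n : ℕ => Real.exp (-(Real.exp (n * ε) / 2))) Filter.atTop
      (nhds 0) :=
    Real.tendsto_exp_neg_atTop_nhds_zero.comp
      ((Real.tendsto_exp_atTop.comp h0).atTop_div_const two_pos)
  have h3 : Filter.Tendsto (fun n : ℕ => 4 * Real.exp (-(2 * n * ε))) Filter.atTop (nhds 0) := by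
    have h4 : Filter.Tendsto (fun n : ℕ => 2 * (n : ℝ) * ε) Filter.atTop Filter.atTop := by
      simpa only [mul_assoc] using h0.const_mul_atTop two_pos
    simpa using (Real.tendsto_exp_neg_atTop_nhds_zero.comp h4).const_mul 4
  have h5 := (h1.add h2).add h3
  simp only [add_zero] at h5
  exact h5

/-- Numbers of messages and keys that make the random code work. -/
lemma exists_sizes {i c ε : ℝ} (hε : 0 < ε) (hc0 : 0 ≤ c) (hci : c ≤ i) (n : ℕ) :
    ∃ M K : ℕ, 0 < M ∧ 0 < K ∧ ∃ κ : ℝ, 0 ≤ κ ∧ κ ≤ c ∧ c - 6 * ε ≤ κ ∧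
      Real.log M ≤ Real.log 2 + n * (i + 2 * ε - κ) ∧ Real.log K ≤ n * κ ∧
      Real.exp (n * ε) / 2 ≤ (M * K : ℕ) / Real.exp (n * (i + ε)) ∧
      (M : ℝ) * K * (K - 1) * (2 * Real.exp (-(n * (i - ε))) * Real.exp (-(n * (c - ε)))) ≤
        4 * Real.exp (-(2 * n * ε)) := by
  have hn : (0 : ℝ) ≤ n := Nat.cast_nonneg n
  -- The key rate. `M K` is about `exp(n(i + 2ε))`, beating the covering threshold `exp(n(i + ε))`;
  -- the packing exponent is `2 - 6 + 1 + 1 = -2` times `nε`. If `c ≤ 6ε` then `K = 1` and there are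
  -- no rivals.
  set κ := max (c - 6 * ε) 0 with hκ
  have hκ0 : 0 ≤ κ := le_max_right _ _
  have hκc : κ ≤ c := max_le (by linarith) hc0
  set K := ⌊Real.exp (n * κ)⌋₊ with hK
  set M := ⌈Real.exp (n * (i + 2 * ε - κ))⌉₊ with hM
  have hexp1 : 1 ≤ Real.exp (n * κ) := Real.one_le_exp (by positivity)
  have hK1 : 1 ≤ K := Nat.le_floor (by simpa using hexp1)
  have hKle : (K : ℝ) ≤ Real.exp (n * κ) := Nat.floor_le (Real.exp_pos _).le
  have hKge : Real.exp (n * κ) / 2 ≤ K := by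
    have h1 := Nat.lt_floor_add_one (Real.exp (n * κ))
    have h2 : (1 : ℝ) ≤ K := by exact_mod_cast hK1
    rw [← hK] at h1
    linarith
  have hMge : Real.exp (n * (i + 2 * ε - κ)) ≤ M := Nat.le_ceil _
  have hMle : (M : ℝ) ≤ 2 * Real.exp (n * (i + 2 * ε - κ)) := by
    have h1 := Nat.ceil_lt_add_one (Real.exp_pos (n * (i + 2 * ε - κ))).le
    have h2 : 1 ≤ Real.exp (n * (i + 2 * ε - κ)) :=
      Real.one_le_exp (mul_nonneg hn (by linarith))
    linarith
  have hMpos : 0 < M := Nat.ceil_pos.2 (Real.exp_pos _)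
  have hMpos' : (0 : ℝ) < M := by exact_mod_cast hMpos
  have hKpos' : (0 : ℝ) < K := by exact_mod_cast hK1
  refine ⟨M, K, hMpos, hK1, κ, hκ0, hκc, le_max_left _ _, ?_, ?_, ?_, ?_⟩
  · calc Real.log M ≤ Real.log (2 * Real.exp (n * (i + 2 * ε - κ))) := Real.log_le_log hMpos' hMle
      _ = _ := by rw [Real.log_mul two_ne_zero (Real.exp_pos _).ne', Real.log_exp]
  · calc Real.log K ≤ Real.log (Real.exp (n * κ)) := Real.log_le_log hKpos' hKle
      _ = _ := Real.log_exp _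
  · rw [le_div_iff₀ (Real.exp_pos _)]
    push_cast
    calc Real.exp (n * ε) / 2 * Real.exp (n * (i + ε))
        = Real.exp (n * (i + 2 * ε - κ)) * (Real.exp (n * κ) / 2) := by
          rw [div_mul_eq_mul_div, ← Real.exp_add, mul_div_assoc', ← Real.exp_add]
          ring_nf
      _ ≤ M * K := mul_le_mul hMge hKge (by positivity) hMpos'.le
  · have hK2 : (K : ℝ) - 1 ≤ Real.exp (n * (c - 6 * ε)) := by
      rcases le_total (c - 6 * ε) 0 with h | h
      · have : K = 1 := by rw [hK, hκ, max_eq_right h]; simp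
        rw [this]
        simpa using (Real.exp_pos _).le
      · rw [hκ, max_eq_left h] at hKle
        linarith
    have hMK : (M : ℝ) * K ≤ 2 * Real.exp (n * (i + 2 * ε)) := by
      calc (M : ℝ) * K ≤ 2 * Real.exp (n * (i + 2 * ε - κ)) * Real.exp (n * κ) :=
            mul_le_mul hMle hKle hKpos'.le (by positivity)
        _ = _ := by rw [mul_assoc, ← Real.exp_add]; ring_nf
    have hK3 : (0 : ℝ) ≤ K - 1 := by
      have h2 : (1 : ℝ) ≤ K := by exact_mod_cast hK1
      linarith
    calc _ ≤ 2 * Real.exp (n * (i + 2 * ε)) * Real.exp (n * (c - 6 * ε)) *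
          (2 * Real.exp (-(n * (i - ε))) * Real.exp (-(n * (c - ε)))) :=
          mul_le_mul_of_nonneg_right (mul_le_mul hMK hK2 hK3 (by positivity)) (by positivity)
      _ = 4 * (Real.exp (n * (i + 2 * ε)) * Real.exp (n * (c - 6 * ε)) *
          Real.exp (-(n * (i - ε))) * Real.exp (-(n * (c - ε)))) := by ring
      _ = _ := by
          rw [← Real.exp_add, ← Real.exp_add, ← Real.exp_add]
          ring_nf

/-- Quantitative achievability, in nats. -/
theorem exists_code_of_infoDensity {J : (X × Y) × V → ℝ} (hJ : J ∈ stdSimplex ℝ ((X × Y) × V))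
    (hp : ∀ z, prob J {s | s.1 = z} = p z) (hp' : p ∈ stdSimplex ℝ (X × Y)) {i i₁ i₂ c ε : ℝ}
    (hi : ∑ s, J s * infoDensity J id s = i) (hi₁ : ∑ s, J s * infoDensity J Prod.fst s = i₁)
    (hi₂ : ∑ s, J s * infoDensity J Prod.snd s = i₂) (hc0 : 0 ≤ c) (hci : c ≤ i) (hc₁ : c ≤ i₁)
    (hc₂ : c ≤ i₂) (hε : 0 < ε) {n : ℕ} (hn : 0 < n) (hη1 : failureBound J ε n ≤ 1) :
    ∃ C : Code X Y n, prob (iidLaw p n) {ω | C.key₁ ω ≠ C.key₂ ω} ≤ failureBound J ε n ∧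
      Real.log C.numMsg ≤ Real.log 2 + n * (i - c + 8 * ε) ∧
      n * (c - 9 * ε - failureBound J ε n * i) - failureBound J ε n - Real.log 2 ≤
        entropy (iidLaw p n) C.key₁ * Real.log 2 ∧
      mutualInfo (iidLaw p n) (fun ω => (C.key₁ ω, C.key₂ ω)) C.relay * Real.log 2 ≤
        2 * Real.log 2 + failureBound J ε n + n * (3 * ε + failureBound J ε n * (c + i)) := by
  classical
  have hn' : (0 : ℝ) < n := by exact_mod_cast hn
  have hℓ : 0 < Real.log 2 := Real.log_pos one_lt_two
  have hq := iidLaw_mem_stdSimplex hp' n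
  set q := iidLaw p n with hqdef
  set η := failureBound J ε n with hη
  obtain ⟨M, K, hM, hK, κ, hκ0, hκc, hκε, hlogM, hlogK, hcov, hpack⟩ := exists_sizes hε hc0 hci n
  obtain ⟨C, hCM, hCK, G, hG, hkey, hatom⟩ := exists_code hq (sndLawSeq_mem_stdSimplex hJ n)
    (fun ω => channelSeq J id fun k => (ω.1 k, ω.2 k)) (fun ω v => channelSeq_nonneg hJ.1 _ _ _)
    (fun ω => sum_channelSeq_le_one hJ.1 _ _) (typicalSet J n i i₁ i₂ ε)
    (fun x => {v | Real.exp (n * (i₁ - ε)) * sndLawSeq J n v ≤ channelSeq J Prod.fst x v})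
    (fun y => {v | Real.exp (n * (i₂ - ε)) * sndLawSeq J n v ≤ channelSeq J Prod.snd y v})
    (a := Real.exp (n * (i + ε))) (b := Real.exp (-(n * (i - ε))))
    (g := Real.exp (-(n * (c - ε)))) (Real.exp_pos _) (fun ω v hv => hv.2.2.1)
    (fun ω => prob_channelSeq_ge_le hJ id _ _ _ fun v hv => hv.2.1)
    (fun v => prob_typicalSet_fiber_le hJ hp hp' i i₁ i₂ ε v)
    (fun x => (prob_channelSeq_ge_le hJ Prod.fst x _ _ fun v hv => hv).trans
      (Real.exp_le_exp.2 (neg_le_neg (mul_le_mul_of_nonneg_left (by linarith) hn'.le))))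
    (fun y => (prob_channelSeq_ge_le hJ Prod.snd y _ _ fun v hv => hv).trans
      (Real.exp_le_exp.2 (neg_le_neg (mul_le_mul_of_nonneg_left (by linarith) hn'.le))))
    (fun ω v hv => hv.2.2.2.1) (fun ω v hv => hv.2.2.2.2) M K hM hK
  have htyp := one_sub_prob_typicalSet_le hJ hp hε hn
  rw [hi, hi₁, hi₂] at htyp
  have hGη : prob q Gᶜ ≤ η := by
    -- The terms of `failureBound` are, in order, an atypical source, no covering codeword, and a
    -- rival in the bin.
    refine hG.trans (add_le_add (add_le_add htyp (Real.exp_le_exp.2 (neg_le_neg hcov))) hpack)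
  have hη0 : 0 ≤ η := (prob_nonneg hq.1 _).trans hGη
  have herr : prob q {ω | C.key₁ ω ≠ C.key₂ ω} ≤ η :=
    (prob_mono hq.1 (T := Gᶜ) fun ω (hω : C.key₁ ω ≠ C.key₂ ω) hωG => hω (hkey ω hωG)).trans hGη
  have hjoint : (1 - η) * (n * (i - ε)) - η ≤
      entropy q (fun ω => (C.relay ω, C.key₁ ω)) * Real.log 2 := by
    -- The atom bound `exp(-n(i - ε))` is at most `1` only if `ε ≤ i`; otherwise the left side is
    -- nonpositive.
    rcases le_total ε i with h | h
    · have := le_entropy_of_prob_inter_le hq (fun ω => (C.relay ω, C.key₁ ω)) G (Real.exp_pos _)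
        hGη hatom (Real.exp_le_one_iff.2 (neg_nonpos.2 (mul_nonneg hn'.le (by linarith))))
      rw [Real.log_exp] at this
      linarith
    · have h1 := mul_nonneg (entropy_nonneg hq (fun ω => (C.relay ω, C.key₁ ω))) hℓ.le
      have h2 := mul_nonneg (sub_nonneg.2 hη1) (mul_nonneg hn'.le (sub_nonneg.2 h))
      linarith
  have hlog2 : ∀ N : ℕ, Real.logb 2 N * Real.log 2 = Real.log N := fun N =>
    div_mul_cancel₀ _ hℓ.ne'
  have hrelay : entropy q C.relay * Real.log 2 ≤ Real.log M := by
    have := mul_le_mul_of_nonneg_right (entropy_le_logb_card hq C.relay) hℓ.le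
    rw [Fintype.card_fin, hlog2] at this
    exact this.trans_eq (by rw [hCM])
  have hkey2 : entropy q C.key₂ * Real.log 2 ≤ Real.log K := by
    have := mul_le_mul_of_nonneg_right (entropy_le_logb_card hq C.key₂) hℓ.le
    rw [Fintype.card_fin, hlog2] at this
    exact this.trans_eq (by rw [hCK])
  have hlogK0 : 0 ≤ Real.log K := Real.log_nonneg (by exact_mod_cast hK)
  have hKc : Real.log K ≤ n * c := hlogK.trans (mul_le_mul_of_nonneg_left hκc hn'.le)
  have hfano : condEntropy q C.key₁ C.key₂ * Real.log 2 ≤ Real.log 2 + η * (n * c) := by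
    have h1 := condEntropy_le_fano hq C.key₁ C.key₂ Finset.univ (fun _ => Finset.mem_univ _)
      (N := K) (by exact_mod_cast hK) (by rw [Finset.card_univ, Fintype.card_fin, hCK])
    have h2 := mul_le_mul_of_nonneg_right h1 hℓ.le
    rw [add_mul, one_mul, mul_assoc, hlog2] at h2
    have h3 := mul_le_mul herr hKc hlogK0 hη0
    linarith
  have hηnε : 0 ≤ η * (n * ε) := by positivity
  refine ⟨C, herr, ?_, ?_, ?_⟩
  · rw [hCM]
    nlinarith
  · have h1 := mul_le_mul_of_nonneg_right (entropy_prod_le hq C.relay C.key₁) hℓ.le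
    rw [add_mul] at h1
    nlinarith
  -- The leakage is at most `H(K₁ | K₂) + log K + log M - H(W_c, K₁)`; `κ` cancels in `log K + log
  -- M`, which nearly equals the joint entropy.
  · have h1 : entropy q (fun ω => (C.relay ω, C.key₁ ω)) ≤
        entropy q (fun ω => ((C.key₁ ω, C.key₂ ω), C.relay ω)) :=
      entropy_mono hq.1 fun _ _ h => by simp only [Prod.mk.injEq] at h ⊢; tauto
    have h2 := mul_le_mul_of_nonneg_right h1 hℓ.le
    simp only [mutualInfo, condEntropy, sub_mul] at hfano ⊢
    nlinarith

theorem achievable_of_auxRates (hp : p ∈ stdSimplex ℝ (X × Y)) {r : ℝ × ℝ} (h1 : 0 ≤ r.1)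
    (h2 : 0 ≤ r.2) (h : AuxRates p r) : Achievable p r.1 r.2 := by
  obtain ⟨m, -, w, hw, hRc, hRk⟩ := h
  have hℓ : 0 < Real.log 2 := Real.log_pos one_lt_two
  refine ⟨h1, h2, fun δ hδ => ?_⟩
  set J := jointLaw p w with hJdef
  have hJ : J ∈ stdSimplex ℝ ((X × Y) × Fin m) := jointLaw_mem_stdSimplex hp hw
  have hmarg : ∀ z, prob J {s | s.1 = z} = p z := jointLaw_fst_law hw
  set I := mutualInfo J (fun s => s.1) (fun s => s.2) with hI
  set I₁ := mutualInfo J (fun s => s.1.1) (fun s => s.2) with hI₁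
  set I₂ := mutualInfo J (fun s => s.1.2) (fun s => s.2) with hI₂
  have e₁ : condMutualInfo J (fun ω => ω.1.1) (fun ω => ω.2) (fun ω => ω.1.2) = I - I₂ := by
    rw [hI, hI₂, hJdef, condMutualInfo_jointLaw_fst hp hw, mutualInfo_jointLaw hw Prod.snd,
      mutualInfo_jointLaw hw fun z => z]
    ring
  have e₂ : condMutualInfo J (fun ω => ω.1.2) (fun ω => ω.2) (fun ω => ω.1.1) = I - I₁ := by
    rw [hI, hI₁, hJdef, condMutualInfo_jointLaw_snd hp hw, mutualInfo_jointLaw hw Prod.fst,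
      mutualInfo_jointLaw hw fun z => z]
    ring
  rw [e₁, e₂] at hRc
  obtain ⟨hRc₂, hRc₁⟩ := max_le_iff.1 hRc
  obtain ⟨hRk₁, hRk₂⟩ := le_min_iff.1 hRk
  have hI₁0 : 0 ≤ I₁ := mutualInfo_nonneg hJ _ _
  have hI₂0 : 0 ≤ I₂ := mutualInfo_nonneg hJ _ _
  set c := min I₁ I₂ with hc
  have hc0 : 0 ≤ c := le_min hI₁0 hI₂0
  have hI₁I : I₁ ≤ I := by
    have : 0 ≤ I - I₁ := by
      rw [← e₂]
      exact sub_nonneg.2 (condEntropy_prod_le hJ _ _ _)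
    linarith
  have hcI : c ≤ I := (min_le_left _ _).trans hI₁I
  have hRkc : r.2 ≤ c := le_min hRk₁ hRk₂
  -- The larger of `I - I₁` and `I - I₂` is `I - min I₁ I₂`, so one `c` serves both rate
  -- constraints.
  have hRcc : I - c ≤ r.1 := by
    rcases min_choice I₁ I₂ with h | h <;> rw [hc, h] <;> linarith
  -- Converts `δ` from bits to nats; the total losses, at most `11 n ε` with the bounded terms
  -- absorbed for large `n`, fit within `20 n ε`.
  set ε := δ * Real.log 2 / 20 with hε
  have hε0 : 0 < ε := by positivity
  have hη := tendsto_failureBound J hε0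
  have hηI : Filter.Tendsto (fun n => failureBound J ε n * ((c + I) * Real.log 2))
      Filter.atTop (nhds 0) := by
    simpa using hη.mul_const ((c + I) * Real.log 2)
  have hev := (hη.eventually_le_const (show (0 : ℝ) < min δ 1 by positivity)).and
    ((hηI.eventually_le_const hε0).and ((Filter.eventually_gt_atTop 0).and
      ((tendsto_natCast_atTop_atTop (R := ℝ)).eventually_ge_atTop
        ((2 * Real.log 2 + 1) / ε))))
  have hcode : ∀ n : ℕ, ∃ C : Code X Y n, (failureBound J ε n ≤ min δ 1 ∧
      failureBound J ε n * ((c + I) * Real.log 2) ≤ ε ∧ 0 < n ∧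
      (2 * Real.log 2 + 1) / ε ≤ (n : ℝ)) →
      prob (iidLaw p n) {ω | C.key₁ ω ≠ C.key₂ ω} ≤ δ ∧
      1 / (n : ℝ) * Real.logb 2 C.numMsg ≤ r.1 + δ ∧
      r.2 - δ ≤ 1 / (n : ℝ) * entropy (iidLaw p n) C.key₁ ∧
      1 / (n : ℝ) * mutualInfo (iidLaw p n) (fun ω => (C.key₁ ω, C.key₂ ω)) C.relay ≤ δ := by
    intro n
    by_cases hcond : failureBound J ε n ≤ min δ 1 ∧
      failureBound J ε n * ((c + I) * Real.log 2) ≤ ε ∧ 0 < n ∧ (2 * Real.log 2 + 1) / ε ≤ (n : ℝ)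
    swap
    -- A trivial code for the lengths that are too small to matter.
    · exact ⟨⟨1, 1, fun _ => 0, fun _ => 0, fun _ => 0⟩, fun h => absurd h hcond⟩
    obtain ⟨hη1, hη2, hn, hn2⟩ := hcond
    have hn' : (0 : ℝ) < n := by exact_mod_cast hn
    have hη3 := hη1.trans (min_le_right _ _)
    obtain ⟨C, g1, g2, g3, g4⟩ := exists_code_of_infoDensity (c := c * Real.log 2) hJ hmarg hp
      (sum_mul_infoDensity hJ.1 id) (sum_mul_infoDensity hJ.1 Prod.fst)
      (sum_mul_infoDensity hJ.1 Prod.snd) (by positivity)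
      (mul_le_mul_of_nonneg_right hcI hℓ.le)
      (mul_le_mul_of_nonneg_right (min_le_left _ _) hℓ.le)
      (mul_le_mul_of_nonneg_right (min_le_right _ _) hℓ.le) hε0 hn hη3
    simp only [id] at g2 g3 g4
    rw [← hI] at g2 g3 g4
    rw [div_le_iff₀ hε0] at hn2
    set η := failureBound J ε n with hηdef
    have hη0 : 0 ≤ η := (prob_nonneg (iidLaw_mem_stdSimplex hp n).1 _).trans g1
    have hδε : δ * Real.log 2 = 20 * ε := by rw [hε]; ring
    have hcη : 0 ≤ η * (c * Real.log 2) := by positivity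
    have hIη : η * (I * Real.log 2) ≤ ε := by nlinarith
    have hnη := mul_le_mul_of_nonneg_left hIη hn'.le
    have hnη2 := mul_le_mul_of_nonneg_left hη2 hn'.le
    have hnε : 0 < n * ε := by positivity
    refine ⟨C, fun _ => ⟨g1.trans (hη1.trans (min_le_left _ _)), ?_, ?_, ?_⟩⟩
    · rw [one_div_mul_eq_div, div_le_iff₀ hn', Real.logb, div_le_iff₀ hℓ]
      have h3 : n * ((I - c) * Real.log 2) ≤ n * (r.1 * Real.log 2) :=
        mul_le_mul_of_nonneg_left (mul_le_mul_of_nonneg_right hRcc hℓ.le) hn'.le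
      have h4 : (r.1 + δ) * n * Real.log 2 = n * (r.1 * Real.log 2) + n * (20 * ε) := by
        rw [← hδε]; ring
      rw [h4]
      linarith
    · rw [one_div_mul_eq_div, le_div_iff₀ hn']
      refine le_of_mul_le_mul_right (le_trans ?_ g3) hℓ
      have h3 : n * (r.2 * Real.log 2) ≤ n * (c * Real.log 2) :=
        mul_le_mul_of_nonneg_left (mul_le_mul_of_nonneg_right hRkc hℓ.le) hn'.le
      have h4 : (r.2 - δ) * n * Real.log 2 = n * (r.2 * Real.log 2) - n * (20 * ε) := by
        rw [← hδε]; ring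
      rw [h4]
      linarith
    · rw [one_div_mul_eq_div, div_le_iff₀ hn']
      refine le_of_mul_le_mul_right (g4.trans ?_) hℓ
      have h4 : δ * n * Real.log 2 = n * (20 * ε) := by
        rw [← hδε]; ring
      rw [h4]
      linarith
  choose C hC using hcode
  exact ⟨C, hev.mono fun n hn => hC n hn⟩

end Achievability

end KeyRelay

/-! ### The rate region -/

theorem theorem4 {X Y : Type*} [Fintype X] [Fintype Y] (p : X × Y → ℝ)
    (hp : p ∈ stdSimplex ℝ (X × Y)) :
    KeyRelay.rateRegion p =
      {r : ℝ × ℝ | 0 ≤ r.1 ∧ 0 ≤ r.2 ∧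
        ∃ m : ℕ, m ≤ Fintype.card X * Fintype.card Y + 2 ∧
          ∃ w : X × Y → Fin m → ℝ, (∀ z, w z ∈ stdSimplex ℝ (Fin m)) ∧
            max (KeyRelay.condMutualInfo (KeyRelay.jointLaw p w)
                  (fun ω => ω.1.1) (fun ω => ω.2) (fun ω => ω.1.2))
                (KeyRelay.condMutualInfo (KeyRelay.jointLaw p w)
                  (fun ω => ω.1.2) (fun ω => ω.2) (fun ω => ω.1.1)) ≤ r.1 ∧
            r.2 ≤ min (KeyRelay.mutualInfo (KeyRelay.jointLaw p w)
                  (fun ω => ω.1.1) (fun ω => ω.2))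
                (KeyRelay.mutualInfo (KeyRelay.jointLaw p w)
                  (fun ω => ω.1.2) (fun ω => ω.2))} := by
  have hclosed : IsClosed {r : ℝ × ℝ | 0 ≤ r.1 ∧ 0 ≤ r.2 ∧ KeyRelay.AuxRates p r} :=
    (isClosed_le continuous_const continuous_fst).inter
      ((isClosed_le continuous_const continuous_snd).inter (KeyRelay.isClosed_auxRates p))
  -- Every pair on the right is itself achievable, so the closure matters only for the converse,
  -- where closedness of the right side absorbs it.
  refine Set.Subset.antisymm (closure_minimal ?_ hclosed) fun r hr => subset_closure ?_
  · rintro ⟨Rc, Rk⟩ h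
    exact ⟨h.1, h.2.1, KeyRelay.auxRates_of_achievable hp h⟩
  · exact KeyRelay.achievable_of_auxRates hp hr.1 hr.2.1 hr.2.2
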